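/- Let $f:\mathbb R^n\to\mathbb R^n$ be a polynomial vector field of degree at most $q$, let $\|\cdot\|$ be the Euclidean norm and $B_\rho=\{x:\|x\|\le\rho\}$, and let $M\subseteq B_r$ be nonempty. Let $\lambda>0$, $K\ge1$, and let $L>0$ be a Lipschitz constant of $f$ on $B_{4Kr}$. Let $T>0$ and the positive integers $N_0,k$ be such that $$T<\frac1{2L},\qquad N_0T>\frac{\log(2K^2)}{2\lambda},\qquad c<K,$$ $$c^2+\frac{\log(2K^2)}{2\lambda}\,K\,\frac{(TL)^k}{T}\,(1+c)(K+c)<\frac12,\qquad c^2<\frac{\lambda}{KL\log(2K^2)}\Bigl(1-(2K^2)^{-L/\lambda}\Bigr),$$ where $$c=\sum_{i=0}^{N_0-1}\bigl(e^{TL}+K(TL)^k\bigr)^iK^2(TL)^k .$$ Put $d=q^{N_0k-1}$ and $N=\frac{(n+d)!}{n!\,d!}$, and let $Z(x)\in\mathbb R^N$ be the vector of all monomials in $x_1,\dots,x_n$ of degree at most $d$. Suppose that $\dot x=f(x)$ is exponentially stable on $M$ with constant $K$ and decay rate $\lambda$ or greater: there is $\mu\ge\lambda$ such that for every $x_0\in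 M$ the solution $x(t)$ with $x(0)=x_0$ exists for all $t\ge0$ and satisfies $\|x(t)\|\le K\|x_0\|e^{-\mu t}$ for all $t\ge 0$. Then there exist constants $\alpha,\beta,\gamma>0$ and a symmetric positive semidefinite matrix $P\in\mathbb R^{N\times N}$ such that for all $x\in M$ $$\alpha\|x\|^2\le Z(x)^TPZ(x)\le\beta\|x\|^2,\qquad \nabla\bigl(Z(x)^TPZ(x)\bigr)^Tf(x)\le-\gamma\|x\|^2 .$$ -/

import Mathlib

noncomputable section

namespace ConverseSOS

/-- The polynomial map `ℝⁿ → ℝⁿ` (Euclidean norm) with components `f 0, …, f (n - 1)`. -/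
def vectorField {n : ℕ} (f : Fin n → MvPolynomial (Fin n) ℝ)
    (x : EuclideanSpace ℝ (Fin n)) : EuclideanSpace ℝ (Fin n) :=
  WithLp.toLp 2 fun i => MvPolynomial.eval (fun j => x j) (f i)

/-- `φ` is a solution on `[0, ∞)` of `φ' = F(φ)`, `φ(0) = x₀`. -/
def IsSolution {n : ℕ} (F : EuclideanSpace ℝ (Fin n) → EuclideanSpace ℝ (Fin n))
    (x₀ : EuclideanSpace ℝ (Fin n)) (φ : ℝ → EuclideanSpace ℝ (Fin n)) : Prop :=
  φ 0 = x₀ ∧ IsIntegralCurveOn φ (fun _ => F) (Set.Ici 0)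

/-- Exponential stability on `M` with overshoot constant `K` and decay rate `rate`: every initial
value `x₀ ∈ M` has a solution that exists for all `t ≥ 0`, and it satisfies
`‖φ(t)‖ ≤ K ‖x₀‖ exp (-rate * t)`.  (For locally Lipschitz `F`, such as a polynomial map, the
solution is unique.) -/
def ExpStableOn {n : ℕ} (F : EuclideanSpace ℝ (Fin n) → EuclideanSpace ℝ (Fin n))
    (M : Set (EuclideanSpace ℝ (Fin n))) (K rate : ℝ) : Prop :=
  ∀ x₀ ∈ M, ∃ φ : ℝ → EuclideanSpace ℝ (Fin n), IsSolution F x₀ φ ∧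
    ∀ t : ℝ, 0 ≤ t → ‖φ t‖ ≤ K * ‖x₀‖ * Real.exp (-rate * t)

/-- `c(k) = ∑_{i=0}^{N-1} (e^{TL} + K (TL)^k)^i K² (TL)^k`. -/
def picardError (K L T : ℝ) (N k : ℕ) : ℝ :=
  ∑ i ∈ Finset.range N,
    (Real.exp (T * L) + K * (T * L) ^ k) ^ i * (K ^ 2 * (T * L) ^ k)

/-- The inequalities on `T`, `N` and `k` under which `2 * q ^ (N * k - 1)` is the degree bound
for the parameters `L`, `rate`, `K` (with `q` the degree of the vector field). -/
structure Admissible (K rate L T : ℝ) (N k : ℕ) : Prop where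
  T_pos : 0 < T
  T_lt : T < 1 / (2 * L)
  N_pos : 0 < N
  k_pos : 0 < k
  horizon : Real.log (2 * K ^ 2) / (2 * rate) < N * T
  error_lt : picardError K L T N k < K
  decrease :
    picardError K L T N k ^ 2 +
      Real.log (2 * K ^ 2) / (2 * rate) * K * ((T * L) ^ k / T) *
        (1 + picardError K L T N k) * (K + picardError K L T N k) < 1 / 2
  positivity :
    picardError K L T N k ^ 2 <
      rate / (K * L * Real.log (2 * K ^ 2)) * (1 - (2 * K ^ 2) ^ (-(L / rate)))

/-- The exponent vectors of the monomials in `n` variables of degree at most `d`. -/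
abbrev Exponents (n d : ℕ) : Type := {m : Fin n → ℕ // ∑ i, m i ≤ d}

/-- `(n + d)! / (n! d!)`. -/
def numMonomials (n d : ℕ) : ℕ := (n + d).factorial / (n.factorial * d.factorial)

/-- Homogenization: add the exponent of one more variable. -/
def exponentsEquiv (n d : ℕ) : Exponents n d ≃ {P : Fin (n + 1) → ℕ // ∑ i, P i = d} where
  toFun m := ⟨Fin.cons (d - ∑ i, m.1 i) m.1, by
    have := m.2
    rw [Fin.sum_univ_succ]
    simp only [Fin.cons_zero, Fin.cons_succ]
    omega⟩
  invFun P := ⟨Fin.tail P.1, by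
    have := P.2
    rw [Fin.sum_univ_succ] at this
    simp only [Fin.tail]
    omega⟩
  left_inv m := by simp
  right_inv P := by
    apply Subtype.ext
    have := P.2
    rw [Fin.sum_univ_succ] at this
    funext j
    refine Fin.cases ?_ (fun i => ?_) j
    · simp only [Fin.cons_zero, Fin.tail]
      omega
    · simp only [Fin.cons_succ, Fin.tail]

theorem card_exponents (n d : ℕ) : Nat.card (Exponents n d) = numMonomials n d := by
  rw [Nat.card_congr ((exponentsEquiv n d).trans (Sym.equivNatSumOfFintype (Fin (n + 1)) d).symm),
    Nat.card_eq_fintype_card, Sym.card_sym_eq_choose, Fintype.card_fin, numMonomials]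
  have h : n + 1 + d - 1 = n + d := by omega
  rw [h, ← Nat.choose_symm_add, Nat.choose_eq_factorial_div_factorial (by omega)]
  simp

theorem numMonomials_pos (n d : ℕ) : 0 < numMonomials n d :=
  Nat.div_pos (Nat.le_of_dvd (Nat.factorial_pos _) (Nat.factorial_mul_factorial_dvd_factorial_add n d))
    (by positivity)

/-- An enumeration of the monomials in `n` variables of degree at most `d`. -/
def exponentsEnum (n d : ℕ) : Fin (numMonomials n d) ≃ Exponents n d :=
  haveI : Finite (Exponents n d) :=
    Nat.finite_of_card_ne_zero (by rw [card_exponents]; exact (numMonomials_pos n d).ne')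
  (Finite.equivFinOfCardEq (card_exponents n d)).symm

/-- `Z(x)`: the vector of all monomials in `x` of degree at most `d`. -/
def monomialVector (n d : ℕ) (x : EuclideanSpace ℝ (Fin n)) : Fin (numMonomials n d) → ℝ :=
  fun a => ∏ i, x i ^ (exponentsEnum n d a).1 i

/-- `Z(x)ᵀ P Z(x)`. -/
def gramForm {n d : ℕ} (P : Matrix (Fin (numMonomials n d)) (Fin (numMonomials n d)) ℝ)
    (x : EuclideanSpace ℝ (Fin n)) : ℝ :=
  monomialVector n d x ⬝ᵥ P.mulVec (monomialVector n d x)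

end ConverseSOS

end

open MeasureTheory Filter Topology

noncomputable section

namespace ConverseSOS

/-! ### Frozen Picard iterates: distance to the flow and defect under time shifts. -/

section

/-- `(L t)ʲ / j!`, the a priori size of the error of the `j`-th Picard iterate. -/
def expTerm (L : ℝ) (j : ℕ) (t : ℝ) : ℝ := (L * t) ^ j / j.factorial

theorem expTerm_zero (L t : ℝ) : expTerm L 0 t = 1 := by simp [expTerm]

theorem continuous_expTerm (L : ℝ) (j : ℕ) : Continuous (expTerm L j) := by
  unfold expTerm; fun_prop

theorem expTerm_nonneg {L t : ℝ} (hL : 0 ≤ L) (ht : 0 ≤ t) (j : ℕ) : 0 ≤ expTerm L j t := by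
  unfold expTerm; positivity

theorem expTerm_mono {L s t : ℝ} (hL : 0 ≤ L) (hs : 0 ≤ s) (hst : s ≤ t) (j : ℕ) :
    expTerm L j s ≤ expTerm L j t := by
  unfold expTerm
  gcongr

theorem hasDerivAt_expTerm_succ (L : ℝ) (j : ℕ) (t : ℝ) :
    HasDerivAt (expTerm L (j + 1)) (L * expTerm L j t) t := by
  have h := (((hasDerivAt_id t).const_mul L).pow (j + 1)).div_const ((j + 1).factorial : ℝ)
  refine h.congr_deriv ?_
  have h1 : (j.factorial : ℝ) ≠ 0 := by positivity
  rw [expTerm, Nat.factorial_succ]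
  push_cast
  simp only [id]
  field_simp

theorem integral_expTerm_add (L h t : ℝ) (j : ℕ) :
    ∫ s in (0 : ℝ)..t, L * expTerm L j (s + h) = expTerm L (j + 1) (t + h) - expTerm L (j + 1) h := by
  have hc : Continuous fun s : ℝ => L * expTerm L j (s + h) :=
    continuous_const.mul ((continuous_expTerm L j).comp (continuous_id.add continuous_const))
  rw [intervalIntegral.integral_eq_sub_of_hasDerivAt
    (f := fun s => expTerm L (j + 1) (s + h)) (fun s _ => ?_) (hc.intervalIntegrable _ _)]
  · simp
  · exact (hasDerivAt_expTerm_succ L j (s + h)).comp_add_const s h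

theorem integral_expTerm (L t : ℝ) (j : ℕ) :
    ∫ s in (0 : ℝ)..t, L * expTerm L j s = expTerm L (j + 1) t := by
  have h := integral_expTerm_add L 0 t j
  simpa [expTerm] using h

/-- Cut-off times: `(L a_j)ʲ⁺¹ = (j + 1)!`. -/
structure IsCutoff (L : ℝ) (a : ℕ → ℝ) : Prop where
  nonneg : ∀ j, 0 ≤ a j
  eq_one : ∀ j, expTerm L (j + 1) (a j) = 1

theorem exists_isCutoff {L : ℝ} (hL : 0 < L) : ∃ a, IsCutoff L a := by
  refine ⟨fun j => (((j + 1).factorial : ℝ) ^ (((j + 1 : ℕ) : ℝ)⁻¹)) / L,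
    fun j => by positivity, fun j => ?_⟩
  rw [expTerm, mul_div_cancel₀ _ hL.ne', Real.rpow_inv_natCast_pow (by positivity) (by omega),
    div_self (by positivity)]

theorem IsCutoff.inv_le {L : ℝ} {a : ℕ → ℝ} (ha : IsCutoff L a) (hL : 0 < L) (j : ℕ) :
    1 / L ≤ a j := by
  by_contra! h
  have h0 := ha.nonneg j
  have h1 : L * a j < 1 := by rw [lt_div_iff₀ hL] at h; linarith
  have h2 := ha.eq_one j
  have h3 : (L * a j) ^ (j + 1) < 1 := pow_lt_one₀ (by positivity) h1 (by omega)
  have h4 : (1 : ℝ) ≤ (j + 1).factorial := by exact_mod_cast Nat.factorial_pos _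
  rw [expTerm, div_eq_one_iff_eq (by positivity)] at h2
  linarith

variable {E : Type*} [NormedAddCommGroup E]

/-- `F` vanishes at `0` and is Lipschitz on the ball of radius `ρ`. -/
structure IsLipschitzField (F : E → E) (L ρ : ℝ) : Prop where
  continuous : Continuous F
  map_zero : F 0 = 0
  lip : ∀ x y, ‖x‖ ≤ ρ → ‖y‖ ≤ ρ → ‖F x - F y‖ ≤ L * ‖x - y‖

theorem IsLipschitzField.norm_le {F : E → E} {L ρ : ℝ} {x : E} (hF : IsLipschitzField F L ρ) (hx : ‖x‖ ≤ ρ) :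
    ‖F x‖ ≤ L * ‖x‖ := by
  have := hF.lip x 0 hx (by simpa using (norm_nonneg x).trans hx)
  simpa [hF.map_zero] using this

variable [NormedSpace ℝ E]

/-- Picard iterates of `y' = F(y)`, `y(0) = x`, where the `j`-th iterate is frozen after `a j`. -/
def picard (F : E → E) (a : ℕ → ℝ) : ℕ → ℝ → E → E
  | 0, _, x => x
  | j + 1, t, x => x + ∫ s in (0 : ℝ)..min t (a j), F (picard F a j s x)

/-- `φ` solves `φ' = F(φ)`, `φ(0) = x` on `[0, ∞)` in integrated form and is bounded by `B`. -/
structure IsTrajectory (F : E → E) (x : E) (φ : ℝ → E) (B : ℝ) : Prop where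
  continuous : Continuous φ
  eq_integral : ∀ t, 0 ≤ t → φ t = x + ∫ s in (0 : ℝ)..t, F (φ s)
  norm_le : ∀ t, 0 ≤ t → ‖φ t‖ ≤ B

variable {F : E → E} {a : ℕ → ℝ} {L ρ B : ℝ} {x : E} {φ : ℝ → E}

theorem continuous_picard (hF : Continuous F) (j : ℕ) (x : E) :
    Continuous fun t => picard F a j t x := by
  induction j with
  | zero => exact continuous_const
  | succ j ih =>
    have h := intervalIntegral.continuous_primitive
      (fun u v => (hF.comp ih).intervalIntegrable (μ := volume) u v) 0
    exact continuous_const.add (h.comp (continuous_id.min continuous_const))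

theorem IsTrajectory.map_zero (hφ : IsTrajectory F x φ B) : φ 0 = x := by
  simpa using hφ.eq_integral 0 le_rfl

theorem IsTrajectory.bound_nonneg (hφ : IsTrajectory F x φ B) : 0 ≤ B :=
  (norm_nonneg _).trans (hφ.norm_le 0 le_rfl)

/-- Keeping the same `B` lets the estimates apply at `φ h`, which need not lie in the set where
stability is assumed. -/
theorem IsTrajectory.shift (hF : Continuous F) (hφ : IsTrajectory F x φ B) {h : ℝ} (hh : 0 ≤ h) :
    IsTrajectory F (φ h) (fun t => φ (t + h)) B where
  continuous := hφ.continuous.comp (continuous_id.add continuous_const)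
  eq_integral t ht := by
    have hc := hF.comp hφ.continuous
    have h1 := intervalIntegral.integral_comp_add_right (a := 0) (b := t) (fun s => F (φ s)) h
    have h2 := intervalIntegral.integral_add_adjacent_intervals (a := 0) (b := h) (c := t + h)
      (hc.intervalIntegrable (μ := volume) _ _) (hc.intervalIntegrable _ _)
    simp only [Function.comp_apply] at h2
    rw [zero_add] at h1
    rw [hφ.eq_integral (t + h) (by linarith), hφ.eq_integral h hh, h1, ← h2, add_assoc]
  norm_le t ht := hφ.norm_le _ (by linarith)

theorem IsTrajectory.norm_field_le (hF : IsLipschitzField F L ρ) (hL : 0 ≤ L)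
    (hφ : IsTrajectory F x φ B) (hB : B ≤ ρ) {t : ℝ} (ht : 0 ≤ t) : ‖F (φ t)‖ ≤ L * B :=
  (hF.norm_le ((hφ.norm_le t ht).trans hB)).trans
    (mul_le_mul_of_nonneg_left (hφ.norm_le t ht) hL)

theorem IsTrajectory.norm_sub_le (hF : IsLipschitzField F L ρ) (hL : 0 ≤ L)
    (hφ : IsTrajectory F x φ B) (hB : B ≤ ρ) {t : ℝ} (ht : 0 ≤ t) : ‖φ t - x‖ ≤ L * B * t := by
  rw [hφ.eq_integral t ht, add_sub_cancel_left]
  refine (intervalIntegral.norm_integral_le_of_norm_le_const (C := L * B) fun s hs => ?_).trans ?_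
  · rw [Set.uIoc_of_le ht] at hs
    exact hφ.norm_field_le hF hL hB hs.1.le
  · rw [sub_zero, abs_of_nonneg ht]

/-- Before `a j` the previous iterate has norm at most `2 * B`, so the Lipschitz bound applies.
After `a j` the integrand is only `F (φ s)`, of norm at most `L * B`, and `expTerm L (j + 1) s ≥ 1`
there. Both pieces have the same majorant, whose integral is the next `expTerm`. -/
theorem norm_picard_sub_le (hF : IsLipschitzField F L ρ) (hL : 0 ≤ L) (ha : IsCutoff L a)
    (hφ : IsTrajectory F x φ B) (hB : 2 * B ≤ ρ) (j : ℕ) :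
    ∀ t, 0 ≤ t → ‖picard F a j t x - φ t‖ ≤ B * expTerm L (j + 1) t := by
  have hB0 := hφ.bound_nonneg
  induction j with
  | zero =>
    intro t ht
    rw [norm_sub_rev]
    refine (hφ.norm_sub_le hF hL (by linarith) ht).trans (le_of_eq ?_)
    simp [expTerm]; ring
  | succ j ih =>
    intro t ht
    have hcy : Continuous fun s => F (picard F a j s x) := hF.continuous.comp (continuous_picard (a := a) hF.continuous j x)
    have hcφ : Continuous fun s => F (φ s) := hF.continuous.comp hφ.continuous
    have hm0 : 0 ≤ min t (a j) := le_min ht (ha.nonneg j)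
    have hg : Continuous fun s => B * (L * expTerm L (j + 1) s) :=
      continuous_const.mul (continuous_const.mul (continuous_expTerm _ _))
    have e : picard F a (j + 1) t x - φ t =
        (∫ s in (0 : ℝ)..min t (a j), (F (picard F a j s x) - F (φ s))) -
          ∫ s in min t (a j)..t, F (φ s) := by
      rw [picard, hφ.eq_integral t ht, intervalIntegral.integral_sub
        (hcy.intervalIntegrable _ _) (hcφ.intervalIntegrable _ _),
        ← intervalIntegral.integral_add_adjacent_intervals (b := min t (a j)) (c := t)
          (hcφ.intervalIntegrable (μ := volume) _ _) (hcφ.intervalIntegrable _ _)]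
      abel
    have b1 : ‖∫ s in (0 : ℝ)..min t (a j), (F (picard F a j s x) - F (φ s))‖ ≤
        ∫ s in (0 : ℝ)..min t (a j), B * (L * expTerm L (j + 1) s) := by
      refine intervalIntegral.norm_integral_le_of_norm_le hm0 (Eventually.of_forall fun s hs => ?_)
        (hg.intervalIntegrable _ _)
      have hsa : s ≤ a j := hs.2.trans (min_le_right _ _)
      have h1 := ih s hs.1.le
      have h2 : expTerm L (j + 1) s ≤ 1 := ha.eq_one j ▸ expTerm_mono hL hs.1.le hsa _
      have h3 := hφ.norm_le s hs.1.le
      have h4 : ‖picard F a j s x‖ ≤ ρ := by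
        have := norm_le_norm_add_norm_sub' (picard F a j s x) (φ s)
        nlinarith
      calc _ ≤ L * ‖picard F a j s x - φ s‖ := hF.lip _ _ h4 (by linarith)
        _ ≤ L * (B * expTerm L (j + 1) s) := by gcongr
        _ = _ := by ring
    have b2 : ‖∫ s in min t (a j)..t, F (φ s)‖ ≤
        ∫ s in min t (a j)..t, B * (L * expTerm L (j + 1) s) := by
      refine intervalIntegral.norm_integral_le_of_norm_le (min_le_left _ _)
        (Eventually.of_forall fun s hs => ?_) (hg.intervalIntegrable _ _)
      have has : a j ≤ s := by
        rcases min_lt_iff.1 hs.1 with h | h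
        · exact absurd hs.2 (not_le.2 h)
        · exact h.le
      have h2 : 1 ≤ expTerm L (j + 1) s := ha.eq_one j ▸ expTerm_mono hL (ha.nonneg j) has _
      have h3 := hφ.norm_field_le hF hL (by linarith) ((ha.nonneg j).trans has)
      calc _ ≤ L * B * 1 := by linarith
        _ ≤ L * B * expTerm L (j + 1) s := by gcongr
        _ = _ := by ring
    rw [e]
    refine (norm_sub_le _ _).trans ((add_le_add b1 b2).trans (le_of_eq ?_))
    rw [intervalIntegral.integral_add_adjacent_intervals (hg.intervalIntegrable _ _)
      (hg.intervalIntegrable _ _), intervalIntegral.integral_const_mul, integral_expTerm]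

theorem norm_picard_le (hF : IsLipschitzField F L ρ) (hL : 0 ≤ L) (ha : IsCutoff L a)
    (hφ : IsTrajectory F x φ B) (hB : 2 * B ≤ ρ) (j : ℕ) {t : ℝ} (ht : 0 ≤ t) :
    ‖picard F a j t x‖ ≤ B * (1 + expTerm L (j + 1) t) := by
  have := norm_le_norm_add_norm_sub' (picard F a j t x) (φ t)
  linarith [norm_picard_sub_le hF hL ha hφ hB j t ht, hφ.norm_le t ht]

theorem norm_picard_le_of_le (hF : IsLipschitzField F L ρ) (hL : 0 ≤ L) (ha : IsCutoff L a)
    (hφ : IsTrajectory F x φ B) (hB : 2 * B ≤ ρ) (j : ℕ) {t : ℝ} (ht : 0 ≤ t) (hta : t ≤ a j) :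
    ‖picard F a j t x‖ ≤ 2 * B := by
  have h1 := norm_picard_le hF hL ha hφ hB j ht
  have h2 : expTerm L (j + 1) t ≤ 1 := ha.eq_one j ▸ expTerm_mono hL ht hta _
  nlinarith [hφ.bound_nonneg]

/-- The failure of the approximate flow to commute with time shifts. -/
theorem exists_norm_picard_shift_le (hF : IsLipschitzField F L ρ) (hL : 0 < L)
    (ha : IsCutoff L a) (hφ : IsTrajectory F x φ B) (hB : 2 * B ≤ ρ)
    {w δ h₀ : ℝ} (hδ : 0 ≤ δ) (hw : 0 ≤ w) (h₀L : L * h₀ ≤ 1)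
    (hcut : ∀ j, a j < δ + h₀ → 2 * B ≤ w * ‖x‖) (j : ℕ) :
    ∃ C, 0 ≤ C ∧ ∀ h, 0 ≤ h → h ≤ h₀ → ∀ t, 0 ≤ t → t ≤ δ →
      ‖picard F a j t (φ h) - picard F a j (t + h) x‖ ≤
        h * L * (‖x‖ * (1 + j * w) * expTerm L j (t + h) + C * h) := by
  have hB0 := hφ.bound_nonneg
  induction j with
  | zero =>
    -- The zeroth iterate is constant in time, so the defect is `φ h - x`, of size at most `h L (‖x‖
    -- + L B h)`.
    refine ⟨L * B, by positivity, fun h hh hh₀ t ht htδ => ?_⟩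
    simp only [picard, Nat.cast_zero, zero_mul, add_zero, mul_one, expTerm_zero]
    rw [hφ.eq_integral h hh, add_sub_cancel_left]
    refine (intervalIntegral.norm_integral_le_of_norm_le_const
      (C := L * (‖x‖ + L * B * h)) fun s hs => ?_).trans (le_of_eq ?_)
    · rw [Set.uIoc_of_le hh] at hs
      refine (hF.norm_le ((hφ.norm_le s hs.1.le).trans (by linarith))).trans ?_
      have h1 := hφ.norm_sub_le hF hL.le (by linarith) hs.1.le
      have h2 := norm_le_norm_add_norm_sub' (φ s) x
      have h3 : L * B * s ≤ L * B * h := by have := hs.2; gcongr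
      gcongr
      linarith
    · rw [sub_zero, abs_of_nonneg hh]; ring
  | succ j ih =>
    obtain ⟨C, hC, ih⟩ := ih
    refine ⟨L * δ * C + L * B, by positivity, fun h hh hh₀ t ht htδ => ?_⟩
    have hha : h ≤ a j := by
      refine le_trans ?_ (ha.inv_le hL j)
      rw [le_div_iff₀ hL]; nlinarith
    have hψ := hφ.shift hF.continuous hh
    have hc1 : Continuous fun s => F (picard F a j s (φ h)) := hF.continuous.comp (continuous_picard (a := a) hF.continuous j (φ h))
    have hc2 : Continuous fun s => F (picard F a j s x) := hF.continuous.comp (continuous_picard (a := a) hF.continuous j x)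
    have hc3 : Continuous fun s => F (picard F a j (s + h) x) :=
      hc2.comp (continuous_id.add continuous_const)
    -- Up to time `m` neither the iterate started at `φ h` nor the shifted one is frozen; the
    -- shifted one freezes earlier by `h`.
    set m := min t (a j - h) with hm
    have hm0 : 0 ≤ m := le_min ht (by linarith)
    have hmt : m ≤ t := min_le_left _ _
    have hmM : m ≤ min t (a j) := min_le_min le_rfl (by linarith)
    have e1 : picard F a (j + 1) (t + h) x = picard F a (j + 1) h x +
        ∫ s in (0 : ℝ)..m, F (picard F a j (s + h) x) := by
      have e := intervalIntegral.integral_comp_add_right (a := 0) (b := m)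
        (fun s => F (picard F a j s x)) h
      have e' : min (t + h) (a j) = m + h := by
        rw [hm, ← min_add_add_right, sub_add_cancel]
      rw [picard, picard, e', min_eq_left hha, e, zero_add, add_assoc,
        intervalIntegral.integral_add_adjacent_intervals
          (hc2.intervalIntegrable _ _) (hc2.intervalIntegrable _ _)]
    have e2 : picard F a (j + 1) t (φ h) = φ h +
        ((∫ s in (0 : ℝ)..m, F (picard F a j s (φ h))) +
          ∫ s in m..min t (a j), F (picard F a j s (φ h))) := by
      rw [picard, intervalIntegral.integral_add_adjacent_intervals
          (hc1.intervalIntegrable _ _) (hc1.intervalIntegrable _ _)]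
    have e3 : picard F a (j + 1) t (φ h) - picard F a (j + 1) (t + h) x =
        (φ h - picard F a (j + 1) h x) +
        (∫ s in (0 : ℝ)..m, (F (picard F a j s (φ h)) - F (picard F a j (s + h) x))) +
        ∫ s in m..min t (a j), F (picard F a j s (φ h)) := by
      rw [e1, e2, intervalIntegral.integral_sub
        (hc1.intervalIntegrable _ _) (hc3.intervalIntegrable _ _)]
      abel
    -- The error of an iterate of index at least one is `O(h²)`, hence goes into `C`.
    have b1 : ‖φ h - picard F a (j + 1) h x‖ ≤ h * L * (L * B * h) := by
      rw [norm_sub_rev]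
      refine (norm_picard_sub_le hF hL.le ha hφ hB (j + 1) h hh).trans ?_
      have h1 : expTerm L (j + 2) h ≤ (L * h) ^ 2 := by
        have h2 : L * h ≤ 1 := by nlinarith
        have h3 : (1 : ℝ) ≤ (j + 2).factorial := by exact_mod_cast Nat.factorial_pos _
        have h4 : (L * h) ^ (j + 2) ≤ (L * h) ^ 2 :=
          pow_le_pow_of_le_one (by positivity) h2 (by omega)
        exact (div_le_self (by positivity) h3).trans h4
      calc _ ≤ B * (L * h) ^ 2 := by gcongr
        _ = _ := by ring
    have hcb : Continuous fun s => h * (‖x‖ * (1 + j * w)) * (L * (L * expTerm L j (s + h))) +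
        h * L * (L * (C * h)) := by
      have := (continuous_expTerm L j).comp ((continuous_id (X := ℝ)).add (continuous_const (y := h)))
      exact (continuous_const.mul (continuous_const.mul (continuous_const.mul this))).add
        continuous_const
    have b2 : ‖∫ s in (0 : ℝ)..m, (F (picard F a j s (φ h)) - F (picard F a j (s + h) x))‖ ≤
        h * L * (‖x‖ * (1 + j * w) * expTerm L (j + 1) (t + h) + L * δ * C * h) := by
      refine (intervalIntegral.norm_integral_le_of_norm_le hm0
        (Eventually.of_forall fun s hs => ?_) (hcb.intervalIntegrable _ _)).trans ?_
      · have hsa : s + h ≤ a j := by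
          have := hs.2.trans (min_le_right _ _); linarith
        have n1 := norm_picard_le_of_le hF hL.le ha hψ hB j hs.1.le (by linarith)
        have n2 := norm_picard_le_of_le hF hL.le ha hφ hB j (t := s + h)
          (by linarith [hs.1]) hsa
        refine (hF.lip _ _ (n1.trans hB) (n2.trans hB)).trans ?_
        have := ih h hh hh₀ s hs.1.le (hs.2.trans (hmt.trans htδ))
        calc _ ≤ L * (h * L * (‖x‖ * (1 + j * w) * expTerm L j (s + h) + C * h)) := by gcongr
          _ = _ := by ring
      · rw [intervalIntegral.integral_add (Continuous.intervalIntegrable (by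
            have := (continuous_expTerm L j).comp
              ((continuous_id (X := ℝ)).add (continuous_const (y := h)))
            exact continuous_const.mul (continuous_const.mul (continuous_const.mul this))) _ _)
          intervalIntegrable_const, intervalIntegral.integral_const_mul,
          intervalIntegral.integral_const_mul, integral_expTerm_add,
          intervalIntegral.integral_const, smul_eq_mul, sub_zero]
        have h1 : expTerm L (j + 1) (m + h) - expTerm L (j + 1) h ≤ expTerm L (j + 1) (t + h) := by
          have := expTerm_nonneg hL.le hh (j + 1)
          have := expTerm_mono hL.le (by linarith : 0 ≤ m + h) (by linarith : m + h ≤ t + h) (j + 1)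
          linarith
        calc _ ≤ h * (‖x‖ * (1 + j * w)) * (L * expTerm L (j + 1) (t + h)) +
              δ * (h * L * (L * (C * h))) := by
              have := hmt.trans htδ
              gcongr
          _ = _ := by ring
    -- This interval has length at most `h` and is nontrivial only if `a j < t + h`; then `expTerm L
    -- (j + 1) (t + h) ≥ 1` can be inserted. Each induction step thus adds one `w`.
    have b3 : ‖∫ s in m..min t (a j), F (picard F a j s (φ h))‖ ≤
        h * L * (‖x‖ * w * expTerm L (j + 1) (t + h)) := by
      rcases le_or_gt (t + h) (a j) with hta | hta
      · rw [hm, min_eq_left (by linarith), min_eq_left (by linarith),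
          intervalIntegral.integral_same, norm_zero]
        have := expTerm_nonneg hL.le (by linarith : 0 ≤ t + h) (j + 1)
        positivity
      · have g1 : 1 ≤ expTerm L (j + 1) (t + h) :=
          ha.eq_one j ▸ expTerm_mono hL.le (ha.nonneg j) hta.le _
        have hw' := hcut j (by linarith)
        refine (intervalIntegral.norm_integral_le_of_norm_le_const
          (C := L * (2 * B)) fun s hs => ?_).trans ?_
        · rw [Set.uIoc_of_le hmM] at hs
          have n1 := norm_picard_le_of_le hF hL.le ha hψ hB j (hm0.trans hs.1.le)
            (hs.2.trans (min_le_right _ _))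
          exact (hF.norm_le (n1.trans hB)).trans (by gcongr)
        · have h1 : min t (a j) - m ≤ h := by
            rw [hm, min_eq_right (by linarith : a j - h ≤ t)]
            linarith [min_le_right t (a j)]
          rw [abs_of_nonneg (by linarith)]
          calc L * (2 * B) * (min t (a j) - m) ≤ L * (w * ‖x‖) * h := by gcongr
            _ = h * L * (‖x‖ * w * 1) := by ring
            _ ≤ _ := by gcongr
    rw [e3]
    refine (norm_add₃_le).trans ((add_le_add_three b1 b2 b3).trans (le_of_eq ?_))
    push_cast
    ring

end

/-! ### The integral functional and its derivative along a trajectory. -/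

section

variable {E : Type*} [NormedAddCommGroup E] [NormedSpace ℝ E]
variable {F : E → E} {a : ℕ → ℝ} {L ρ B : ℝ} {x : E} {φ : ℝ → E}

/-- `∫₀^δ ‖y(t, x)‖² dt`, where `y` is the `j`-th Picard iterate. -/
def lyapunov (F : E → E) (a : ℕ → ℝ) (j : ℕ) (δ : ℝ) (x : E) : ℝ :=
  ∫ t in (0 : ℝ)..δ, ‖picard F a j t x‖ ^ 2

theorem continuous_norm_picard_sq (hF : Continuous F) (j : ℕ) (x : E) :
    Continuous fun t => ‖picard F a j t x‖ ^ 2 :=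
  (continuous_picard hF j x).norm.pow 2

theorem expTerm_succ_le (hL : 0 ≤ L) {t : ℝ} (ht : 0 ≤ t) (htL : L * t ≤ 1) (j : ℕ) :
    expTerm L (j + 1) t ≤ L * t := by
  have h3 : (1 : ℝ) ≤ (j + 1).factorial := by exact_mod_cast Nat.factorial_pos _
  refine (div_le_self (by positivity) h3).trans ?_
  exact pow_le_of_le_one (by positivity) htL (by omega)

theorem le_norm_picard (hF : IsLipschitzField F L ρ) (hL : 0 ≤ L) (ha : IsCutoff L a)
    (hφ : IsTrajectory F x φ B) (hB : 2 * B ≤ ρ) (j : ℕ) {t : ℝ} (ht : 0 ≤ t) (htL : L * t ≤ 1) :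
    ‖x‖ - 2 * (L * B * t) ≤ ‖picard F a j t x‖ := by
  have hB0 := hφ.bound_nonneg
  have h1 := norm_picard_sub_le hF hL ha hφ hB j t ht
  have h2 := hφ.norm_sub_le hF hL (by linarith) ht
  have h3 := mul_le_mul_of_nonneg_left (expTerm_succ_le hL ht htL j) hB0
  have h4 := norm_sub_norm_le x (picard F a j t x)
  have h5 := norm_sub_le_norm_sub_add_norm_sub x (φ t) (picard F a j t x)
  rw [norm_sub_rev] at h1 h2
  linarith

theorem lyapunov_le (hF : IsLipschitzField F L ρ) (hL : 0 ≤ L) (ha : IsCutoff L a)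
    (hφ : IsTrajectory F x φ B) (hB : 2 * B ≤ ρ) (j : ℕ) {δ : ℝ} (hδ : 0 ≤ δ) :
    lyapunov F a j δ x ≤ δ * (B * (1 + expTerm L (j + 1) δ)) ^ 2 := by
  have hB0 := hφ.bound_nonneg
  have h : lyapunov F a j δ x ≤ ∫ _ in (0 : ℝ)..δ, (B * (1 + expTerm L (j + 1) δ)) ^ 2 := by
    refine intervalIntegral.integral_mono_on hδ
      ((continuous_norm_picard_sq hF.continuous j x).intervalIntegrable _ _)
      intervalIntegrable_const fun t ht => ?_
    have h1 := norm_picard_le hF hL ha hφ hB j ht.1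
    have h2 := expTerm_mono hL ht.1 ht.2 (j + 1)
    have h3 : B * (1 + expTerm L (j + 1) t) ≤ B * (1 + expTerm L (j + 1) δ) := by gcongr
    gcongr
    exact h1.trans h3
  simpa using h

theorem le_lyapunov (hF : IsLipschitzField F L ρ) (hL : 0 ≤ L) (ha : IsCutoff L a)
    (hφ : IsTrajectory F x φ B) (hB : 2 * B ≤ ρ) (j : ℕ) {δ t₀ : ℝ} (ht₀ : 0 ≤ t₀) (htδ : t₀ ≤ δ)
    (htL : L * t₀ ≤ 1) (htB : 4 * (L * B * t₀) ≤ ‖x‖) :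
    t₀ * (‖x‖ / 2) ^ 2 ≤ lyapunov F a j δ x := by
  have hB0 := hφ.bound_nonneg
  have hc := continuous_norm_picard_sq (a := a) hF.continuous j x
  have h : ∫ _ in (0 : ℝ)..t₀, (‖x‖ / 2) ^ 2 ≤ ∫ t in (0 : ℝ)..t₀, ‖picard F a j t x‖ ^ 2 := by
    refine intervalIntegral.integral_mono_on ht₀ intervalIntegrable_const
      (hc.intervalIntegrable _ _) fun t ht => ?_
    have h0 : L * t ≤ L * t₀ := by have := ht.2; gcongr
    have h1 := le_norm_picard hF hL ha hφ hB j ht.1 (h0.trans htL)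
    have h2 : L * B * t ≤ L * B * t₀ := by have := ht.2; gcongr
    gcongr
    linarith
  have h' : 0 ≤ ∫ t in t₀..δ, ‖picard F a j t x‖ ^ 2 :=
    intervalIntegral.integral_nonneg htδ fun _ _ => by positivity
  rw [intervalIntegral.integral_const, smul_eq_mul, sub_zero] at h
  rw [lyapunov, ← intervalIntegral.integral_add_adjacent_intervals (b := t₀)
    (hc.intervalIntegrable _ _) (hc.intervalIntegrable _ _)]
  linarith

theorem exists_lyapunov_sub_le (hF : IsLipschitzField F L ρ) (hL : 0 < L)
    (ha : IsCutoff L a) (hφ : IsTrajectory F x φ B) (hB : 2 * B ≤ ρ)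
    {w δ h₀ S : ℝ} (hδ : 0 ≤ δ) (hw : 0 ≤ w) (h₀L : L * h₀ ≤ 1)
    (hcut : ∀ j, a j < δ + h₀ → 2 * B ≤ w * ‖x‖) (hS : ∀ t, δ ≤ t → ‖φ t‖ ≤ S) (j : ℕ) :
    ∃ C, ∀ h, 0 ≤ h → h ≤ h₀ → lyapunov F a j δ (φ h) - lyapunov F a j δ x ≤
      h * (2 * B * (1 + expTerm L (j + 1) (δ + h)) *
          (‖x‖ * (1 + j * w) * expTerm L (j + 1) (δ + h) + C * h) +
        (S + B * expTerm L (j + 1) (δ + h)) ^ 2 - (‖x‖ ^ 2 - 4 * ‖x‖ * (L * B * h))) := by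
  obtain ⟨C, hC, hD⟩ := exists_norm_picard_shift_le hF hL ha hφ hB hδ hw h₀L hcut j
  have hB0 := hφ.bound_nonneg
  have hS0 : 0 ≤ S := (norm_nonneg _).trans (hS δ le_rfl)
  refine ⟨δ * L * C, fun h hh hh₀ => ?_⟩
  have hψ := hφ.shift hF.continuous hh
  set g := expTerm L (j + 1) (δ + h) with hg
  have hg0 : 0 ≤ g := expTerm_nonneg hL.le (by linarith) _
  have hc1 := continuous_norm_picard_sq (a := a) hF.continuous j (φ h)
  have hc2 := continuous_norm_picard_sq (a := a) hF.continuous j x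
  have hc3 : Continuous fun t => ‖picard F a j (t + h) x‖ ^ 2 :=
    hc2.comp (continuous_id.add continuous_const)
  have hLh : L * h ≤ 1 := le_trans (by gcongr) h₀L
  have e0 : ∫ t in (0 : ℝ)..δ, ‖picard F a j (t + h) x‖ ^ 2 = lyapunov F a j δ x +
      (∫ t in δ..δ + h, ‖picard F a j t x‖ ^ 2) - ∫ t in (0 : ℝ)..h, ‖picard F a j t x‖ ^ 2 := by
    rw [intervalIntegral.integral_comp_add_right (fun t => ‖picard F a j t x‖ ^ 2), zero_add,
      lyapunov, intervalIntegral.integral_add_adjacent_intervals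
        (hc2.intervalIntegrable _ _) (hc2.intervalIntegrable _ _),
      eq_sub_iff_add_eq', intervalIntegral.integral_add_adjacent_intervals
        (hc2.intervalIntegrable _ _) (hc2.intervalIntegrable _ _)]
  -- Difference of squares and the shift defect; integrating `L * expTerm L j` over time raises the
  -- index to `j + 1`.
  have b1 : lyapunov F a j δ (φ h) - ∫ t in (0 : ℝ)..δ, ‖picard F a j (t + h) x‖ ^ 2 ≤
      h * (2 * B * (1 + g) * (‖x‖ * (1 + j * w) * g + δ * L * C * h)) := by
    have hci : Continuous fun t => 2 * B * (1 + g) * h * (‖x‖ * (1 + j * w)) *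
        (L * expTerm L j (t + h)) :=
      continuous_const.mul (continuous_const.mul
        ((continuous_expTerm L j).comp (continuous_id.add continuous_const)))
    have hcc : Continuous fun t => 2 * B * (1 + g) * h * (‖x‖ * (1 + j * w)) *
        (L * expTerm L j (t + h)) + 2 * B * (1 + g) * h * (L * (C * h)) :=
      hci.add continuous_const
    rw [lyapunov, ← intervalIntegral.integral_sub (hc1.intervalIntegrable _ _)
      (hc3.intervalIntegrable _ _)]
    refine (intervalIntegral.integral_mono_on hδ ((hc1.sub hc3).intervalIntegrable _ _)
      (hcc.intervalIntegrable _ _) fun t ht => ?_).trans ?_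
    · have d := hD h hh hh₀ t ht.1 ht.2
      have ht0 := ht.1
      have htδ := ht.2
      have n1 : ‖picard F a j t (φ h)‖ ≤ B * (1 + g) := by
        refine (norm_picard_le hF hL.le ha hψ hB j ht0).trans ?_
        have := expTerm_mono hL.le ht0 (by linarith : t ≤ δ + h) (j + 1)
        gcongr
      have n2 : ‖picard F a j (t + h) x‖ ≤ B * (1 + g) := by
        refine (norm_picard_le hF hL.le ha hφ hB j (by linarith)).trans ?_
        have := expTerm_mono hL.le (by linarith : 0 ≤ t + h) (by linarith : t + h ≤ δ + h) (j + 1)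
        gcongr
      have d' := norm_sub_norm_le (picard F a j t (φ h)) (picard F a j (t + h) x)
      calc ‖picard F a j t (φ h)‖ ^ 2 - ‖picard F a j (t + h) x‖ ^ 2
          = (‖picard F a j t (φ h)‖ - ‖picard F a j (t + h) x‖) *
            (‖picard F a j t (φ h)‖ + ‖picard F a j (t + h) x‖) := by ring
        _ ≤ ‖picard F a j t (φ h) - picard F a j (t + h) x‖ *
            (‖picard F a j t (φ h)‖ + ‖picard F a j (t + h) x‖) := by gcongr
        _ ≤ (h * L * (‖x‖ * (1 + j * w) * expTerm L j (t + h) + C * h)) *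
            (B * (1 + g) + B * (1 + g)) := by
          have := expTerm_nonneg hL.le (by linarith : 0 ≤ t + h) j
          gcongr
        _ = _ := by ring
    · rw [intervalIntegral.integral_add (hci.intervalIntegrable _ _) intervalIntegrable_const,
        intervalIntegral.integral_const_mul, integral_expTerm_add,
        intervalIntegral.integral_const, smul_eq_mul, sub_zero, ← hg]
      have h1 := expTerm_nonneg hL.le hh (j + 1)
      have h2 : 0 ≤ 2 * B * (1 + g) * h * (‖x‖ * (1 + j * w)) := by positivity
      calc _ ≤ 2 * B * (1 + g) * h * (‖x‖ * (1 + j * w)) * g +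
            δ * (2 * B * (1 + g) * h * (L * (C * h))) := by gcongr; linarith
        _ = _ := by ring
  have b2 : ∫ t in δ..δ + h, ‖picard F a j t x‖ ^ 2 ≤ h * (S + B * g) ^ 2 := by
    refine (intervalIntegral.integral_mono_on (by linarith) (hc2.intervalIntegrable _ _)
      (intervalIntegrable_const (c := (S + B * g) ^ 2)) fun t ht => ?_).trans (le_of_eq ?_)
    · have h1 := norm_picard_sub_le hF hL.le ha hφ hB j t (hδ.trans ht.1)
      have h2 := mul_le_mul_of_nonneg_left
        (expTerm_mono hL.le (hδ.trans ht.1) ht.2 (j + 1)) hB0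
      have h3 := norm_le_norm_add_norm_sub' (picard F a j t x) (φ t)
      have h4 := hS t ht.1
      gcongr
      linarith
    · rw [intervalIntegral.integral_const, smul_eq_mul]; ring
  have b3 : h * (‖x‖ ^ 2 - 4 * ‖x‖ * (L * B * h)) ≤
      ∫ t in (0 : ℝ)..h, ‖picard F a j t x‖ ^ 2 := by
    refine le_trans (le_of_eq ?_) (intervalIntegral.integral_mono_on hh
      (intervalIntegrable_const (c := ‖x‖ ^ 2 - 4 * ‖x‖ * (L * B * h)))
      (hc2.intervalIntegrable _ _) fun t ht => ?_)
    · rw [intervalIntegral.integral_const, smul_eq_mul, sub_zero]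
    · have h0 : L * t ≤ L * h := by have := ht.2; gcongr
      have h1 := le_norm_picard hF hL.le ha hφ hB j ht.1 (h0.trans hLh)
      have h2 : L * B * t ≤ L * B * h := by have := ht.2; gcongr
      -- `‖y‖² ≥ 2‖x‖‖y‖ - ‖x‖²`, which is linear in `‖y‖` and needs no sign of its lower bound.
      nlinarith [sq_nonneg (‖picard F a j t x‖ - ‖x‖), norm_nonneg x]
  rw [e0] at b1
  linarith

theorem lyapunov_deriv_le (hF : IsLipschitzField F L ρ) (hL : 0 < L)
    (ha : IsCutoff L a) (hφ : IsTrajectory F x φ B) (hB : 2 * B ≤ ρ)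
    {w δ h₀ S v : ℝ} (hδ : 0 ≤ δ) (hw : 0 ≤ w) (h₀pos : 0 < h₀) (h₀L : L * h₀ ≤ 1)
    (hcut : ∀ j, a j < δ + h₀ → 2 * B ≤ w * ‖x‖) (hS : ∀ t, δ ≤ t → ‖φ t‖ ≤ S) (j : ℕ)
    (hv : HasDerivWithinAt (fun h => lyapunov F a j δ (φ h)) v (Set.Ici 0) 0) :
    v ≤ 2 * B * (1 + expTerm L (j + 1) δ) * (‖x‖ * (1 + j * w) * expTerm L (j + 1) δ) +
        (S + B * expTerm L (j + 1) δ) ^ 2 - ‖x‖ ^ 2 := by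
  obtain ⟨C, hC⟩ := exists_lyapunov_sub_le hF hL ha hφ hB hδ hw h₀L hcut hS j
  have h1 := hv.Ioi_of_Ici
  rw [hasDerivWithinAt_iff_tendsto_slope' (by simp)] at h1
  set R : ℝ → ℝ := fun h => 2 * B * (1 + expTerm L (j + 1) (δ + h)) *
          (‖x‖ * (1 + j * w) * expTerm L (j + 1) (δ + h) + C * h) +
        (S + B * expTerm L (j + 1) (δ + h)) ^ 2 - (‖x‖ ^ 2 - 4 * ‖x‖ * (L * B * h)) with hR
  have hRc : Continuous R := by
    have : Continuous fun h => expTerm L (j + 1) (δ + h) :=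
      (continuous_expTerm L (j + 1)).comp (continuous_const.add continuous_id)
    fun_prop
  have h2 : Tendsto R (𝓝[>] 0) (𝓝 (R 0)) := hRc.continuousAt.tendsto.mono_left nhdsWithin_le_nhds
  have h3 : v ≤ R 0 := by
    refine le_of_tendsto_of_tendsto h1 h2 ?_
    filter_upwards [Ioc_mem_nhdsGT h₀pos] with h hh
    have := hC h hh.1.le hh.2
    rw [slope_def_field, hφ.map_zero, sub_zero, div_le_iff₀ hh.1, mul_comm]
    exact this
  simpa [hR] using h3

end

/-! ### Polynomial dependence of the iterates on the initial value, and Gram matrices. -/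

section

variable {n : ℕ}

/-- The functions on `ℝⁿ` spanned by the monomials of degree at most `d`. -/
def polySpan (n d : ℕ) : Submodule ℝ (EuclideanSpace ℝ (Fin n) → ℝ) :=
  Submodule.span ℝ (Set.range fun a x => monomialVector n d x a)

instance (n d : ℕ) : FiniteDimensional ℝ (polySpan n d) :=
  FiniteDimensional.span_of_finite ℝ (Set.finite_range _)

theorem mem_polySpan_iff {d : ℕ} {g : EuclideanSpace ℝ (Fin n) → ℝ} :
    g ∈ polySpan n d ↔ ∃ p : MvPolynomial (Fin n) ℝ, p.totalDegree ≤ d ∧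
      ∀ x, g x = MvPolynomial.eval (fun i => x i) p := by
  constructor
  · intro h
    obtain ⟨c, rfl⟩ := (Submodule.mem_span_range_iff_exists_fun ℝ).1 h
    refine ⟨∑ a, MvPolynomial.monomial (Finsupp.equivFunOnFinite.symm (exponentsEnum n d a).1) (c a),
      MvPolynomial.totalDegree_finsetSum_le fun a _ => ?_, fun x => ?_⟩
    · refine (MvPolynomial.totalDegree_monomial_le _ _).trans ?_
      rw [Finsupp.sum_fintype _ _ (by simp)]
      exact (exponentsEnum n d a).2
    · simp only [Finset.sum_apply, Pi.smul_apply, smul_eq_mul, map_sum, MvPolynomial.eval_monomial,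
        monomialVector]
      refine Finset.sum_congr rfl fun a _ => ?_
      rw [Finsupp.prod_fintype _ _ (by simp)]
      simp
  · rintro ⟨p, hp, h⟩
    have e : g = ∑ m ∈ p.support, p.coeff m • fun x : EuclideanSpace ℝ (Fin n) => ∏ i, x i ^ m i := by
      funext x
      rw [h x, MvPolynomial.eval_eq']
      simp
    rw [e]
    refine Submodule.sum_mem _ fun m hm => Submodule.smul_mem _ _ (Submodule.subset_span ?_)
    have hd : ∑ i, m i ≤ d := by
      have := (MvPolynomial.le_totalDegree hm).trans hp
      rwa [Finsupp.sum_fintype _ _ (by simp)] at this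
    refine ⟨(exponentsEnum n d).symm ⟨m, hd⟩, ?_⟩
    funext x
    simp [monomialVector]

theorem coord_mem_polySpan {d : ℕ} (hd : 1 ≤ d) (i : Fin n) :
    (fun x : EuclideanSpace ℝ (Fin n) => x i) ∈ polySpan n d :=
  mem_polySpan_iff.2 ⟨MvPolynomial.X i, by simpa using hd, by simp⟩

theorem eval_comp_mem_polySpan {d q : ℕ} (f : MvPolynomial (Fin n) ℝ) (hf : f.totalDegree ≤ q)
    (g : EuclideanSpace ℝ (Fin n) → EuclideanSpace ℝ (Fin n))
    (hg : ∀ i, (fun x => g x i) ∈ polySpan n d) :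
    (fun x => MvPolynomial.eval (fun i => g x i) f) ∈ polySpan n (d * q) := by
  choose p hpd hp using fun i => mem_polySpan_iff.1 (hg i)
  refine mem_polySpan_iff.2 ⟨∑ m ∈ f.support, MvPolynomial.C (f.coeff m) * ∏ i, p i ^ m i,
    MvPolynomial.totalDegree_finsetSum_le fun m hm => ?_, fun x => ?_⟩
  · have hm' : ∑ i, m i ≤ q := by
      have := (MvPolynomial.le_totalDegree hm).trans hf
      rwa [Finsupp.sum_fintype _ _ (by simp)] at this
    calc _ ≤ (MvPolynomial.C (f.coeff m) : MvPolynomial (Fin n) ℝ).totalDegree +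
          (∏ i, p i ^ m i).totalDegree := MvPolynomial.totalDegree_mul _ _
      _ ≤ 0 + ∑ i, m i * d := by
        gcongr
        · simp
        · refine (MvPolynomial.totalDegree_finsetProd _ _).trans (Finset.sum_le_sum fun i _ => ?_)
          exact (MvPolynomial.totalDegree_pow _ _).trans (Nat.mul_le_mul_left _ (hpd i))
      _ ≤ d * q := by
        rw [zero_add, ← Finset.sum_mul, mul_comm]
        exact Nat.mul_le_mul_left _ hm'
  · rw [MvPolynomial.eval_eq']
    simp [hp]

/-- A linear right inverse of the map from coefficients to functions is continuous, its domain being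
finite-dimensional with the topology of pointwise convergence. Linear independence of the monomials
is not needed. -/
theorem exists_continuous_coeff {d : ℕ} {G : ℝ → EuclideanSpace ℝ (Fin n) → ℝ}
    (hG : ∀ t, G t ∈ polySpan n d) (hc : ∀ x, Continuous fun t => G t x) :
    ∃ C : ℝ → Fin (numMonomials n d) → ℝ, Continuous C ∧
      ∀ t x, G t x = ∑ a, C t a * monomialVector n d x a := by
  let T : (Fin (numMonomials n d) → ℝ) →ₗ[ℝ] polySpan n d :=
    Fintype.linearCombination ℝ fun a => ⟨fun x => monomialVector n d x a,
      Submodule.subset_span ⟨a, rfl⟩⟩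
  have hT : ∀ c x, (T c : EuclideanSpace ℝ (Fin n) → ℝ) x = ∑ a, c a * monomialVector n d x a := by
    intro c x
    simp [T, Fintype.linearCombination_apply]
  have hsurj : LinearMap.range T = ⊤ := by
    rw [LinearMap.range_eq_top]
    rintro ⟨g, hg⟩
    obtain ⟨c, rfl⟩ := (Submodule.mem_span_range_iff_exists_fun ℝ).1 hg
    refine ⟨c, Subtype.ext ?_⟩
    funext x
    rw [hT]
    simp
  obtain ⟨κ, hκ⟩ := T.exists_rightInverse_of_surjective hsurj
  refine ⟨fun t => κ ⟨G t, hG t⟩, ?_, fun t x => ?_⟩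
  · exact κ.continuous_of_finiteDimensional.comp ((continuous_pi hc).subtype_mk _)
  · rw [← hT]
    have := LinearMap.congr_fun hκ ⟨G t, hG t⟩
    simp only [LinearMap.comp_apply, LinearMap.id_apply] at this
    rw [this]

theorem integral_mem_polySpan {d : ℕ} {G : ℝ → EuclideanSpace ℝ (Fin n) → ℝ}
    (hG : ∀ t, G t ∈ polySpan n d) (hc : ∀ x, Continuous fun t => G t x) (u v : ℝ) :
    (fun x => ∫ t in u..v, G t x) ∈ polySpan n d := by
  obtain ⟨C, hC, h⟩ := exists_continuous_coeff hG hc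
  refine (Submodule.mem_span_range_iff_exists_fun ℝ).2 ⟨fun a => ∫ t in u..v, C t a, ?_⟩
  funext x
  have hi : ∀ a ∈ Finset.univ, IntervalIntegrable (fun t => C t a * monomialVector n d x a)
      volume u v := fun a _ =>
    (((continuous_apply a).comp hC).mul continuous_const).intervalIntegrable _ _
  simp only [h]
  rw [intervalIntegral.integral_finsetSum hi]
  simp [intervalIntegral.integral_mul_const]

theorem continuous_vectorField (f : Fin n → MvPolynomial (Fin n) ℝ) :
    Continuous (vectorField f) := by
  refine (PiLp.continuous_toLp 2 _).comp (continuous_pi fun i => ?_)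
  exact (MvPolynomial.continuous_eval (f i)).comp
    (continuous_pi fun j => by fun_prop)

theorem picard_mem_polySpan {q : ℕ} (hq1 : 1 ≤ q) (f : Fin n → MvPolynomial (Fin n) ℝ)
    (hq : ∀ i, (f i).totalDegree ≤ q) (a : ℕ → ℝ) (j : ℕ) :
    ∀ t i, (fun x => picard (vectorField f) a j t x i) ∈ polySpan n (q ^ j) := by
  induction j with
  | zero => intro t i; exact coord_mem_polySpan (by simp) i
  | succ j ih =>
    intro t i
    have hF := continuous_vectorField f
    have hc : ∀ x, Continuous fun s => vectorField f (picard (vectorField f) a j s x) :=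
      fun x => hF.comp (continuous_picard hF j x)
    have e : (fun x => picard (vectorField f) a (j + 1) t x i) = (fun x => x i) + fun x =>
        ∫ s in (0 : ℝ)..min t (a j),
          MvPolynomial.eval (fun l => picard (vectorField f) a j s x l) (f i) := by
      funext x
      have := (EuclideanSpace.proj (𝕜 := ℝ) i).intervalIntegral_comp_comm
        ((hc x).intervalIntegrable (μ := volume) 0 (min t (a j)))
      simp only [PiLp.proj_apply] at this
      simp only [picard, PiLp.add_apply, Pi.add_apply, ← this]
      rfl
    rw [e]
    refine Submodule.add_mem _ (coord_mem_polySpan (Nat.one_le_pow _ _ hq1) i)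
      (integral_mem_polySpan (fun s => ?_) (fun x => ?_) _ _)
    · rw [pow_succ]
      exact eval_comp_mem_polySpan (f i) (hq i) _ (ih s)
    · exact (EuclideanSpace.proj (𝕜 := ℝ) i).continuous.comp (hc x)

/-- An integral of sums of squares of polynomials is the Gram form of a positive semidefinite
matrix. -/
theorem exists_posSemidef_gramForm {d : ℕ}
    {y : ℝ → EuclideanSpace ℝ (Fin n) → EuclideanSpace ℝ (Fin n)}
    (hy : ∀ t i, (fun x => y t x i) ∈ polySpan n d) (hc : ∀ x, Continuous fun t => y t x)
    {δ : ℝ} (hδ : 0 ≤ δ) :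
    ∃ P : Matrix (Fin (numMonomials n d)) (Fin (numMonomials n d)) ℝ, P.PosSemidef ∧
      ∀ x, gramForm P x = ∫ t in (0 : ℝ)..δ, ‖y t x‖ ^ 2 := by
  choose C hC h using fun i => exists_continuous_coeff (hy · i) fun x =>
    (EuclideanSpace.proj (𝕜 := ℝ) i).continuous.comp (hc x)
  have hCa : ∀ i a, Continuous fun t => C i t a := fun i a => (continuous_apply a).comp (hC i)
  let P : Matrix (Fin (numMonomials n d)) (Fin (numMonomials n d)) ℝ :=
    Matrix.of fun a b => ∫ t in (0 : ℝ)..δ, ∑ i, C i t a * C i t b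
  have hP : ∀ v : Fin (numMonomials n d) → ℝ, v ⬝ᵥ P.mulVec v =
      ∫ t in (0 : ℝ)..δ, ∑ i, (∑ a, C i t a * v a) ^ 2 := by
    intro v
    simp only [dotProduct, Matrix.mulVec, P, Matrix.of_apply, Finset.mul_sum]
    simp only [← intervalIntegral.integral_const_mul, ← intervalIntegral.integral_mul_const]
    have hcont : ∀ a b, Continuous fun t => v a * ((∑ i, C i t a * C i t b) * v b) :=
      fun a b => by fun_prop
    rw [Finset.sum_congr rfl fun a _ => (intervalIntegral.integral_finsetSum fun b _ =>
      (hcont a b).intervalIntegrable _ _).symm, ← intervalIntegral.integral_finsetSum fun a _ =>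
      (continuous_finsetSum _ fun b _ => hcont a b).intervalIntegrable _ _]
    refine intervalIntegral.integral_congr fun t _ => ?_
    simp only [sq, Finset.sum_mul, Finset.mul_sum]
    rw [Finset.sum_comm' (t' := Finset.univ) (s' := fun _ => Finset.univ) (by simp)]
    conv_rhs => rw [Finset.sum_comm]
    conv_rhs => enter [2, b]; rw [Finset.sum_comm]
    refine Finset.sum_congr rfl fun b _ => ?_
    refine Finset.sum_congr rfl fun a _ => Finset.sum_congr rfl fun i _ => ?_
    ring
  refine ⟨P, Matrix.PosSemidef.of_dotProduct_mulVec_nonneg ?_ fun v => ?_, fun x => ?_⟩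
  · refine Matrix.IsHermitian.ext fun a b => ?_
    simp only [P, Matrix.of_apply, star_trivial, mul_comm]
  · rw [star_trivial, hP]
    exact intervalIntegral.integral_nonneg hδ fun t _ => Finset.sum_nonneg fun i _ => sq_nonneg _
  · rw [gramForm, hP]
    refine intervalIntegral.integral_congr fun t _ => ?_
    simp only [EuclideanSpace.real_norm_sq_eq]
    exact Finset.sum_congr rfl fun i _ => by rw [← h i t x]

theorem differentiable_gramForm {d : ℕ}
    (P : Matrix (Fin (numMonomials n d)) (Fin (numMonomials n d)) ℝ) :
    Differentiable ℝ (gramForm P) := by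
  have hZ : ∀ a, Differentiable ℝ fun x => monomialVector n d x a := fun a => by
    unfold monomialVector; fun_prop
  unfold gramForm
  simp only [dotProduct, Matrix.mulVec]
  fun_prop

end

/-! ### Numerical inequalities making the derivative negative. -/

theorem mul_le_picardError {K L T : ℝ} (hK : 1 ≤ K) (hTL : 0 ≤ T * L) (N k : ℕ) :
    N * (K ^ 2 * (T * L) ^ k) ≤ picardError K L T N k := by
  rw [picardError]
  have : ∀ i ∈ Finset.range N, K ^ 2 * (T * L) ^ k ≤
      (Real.exp (T * L) + K * (T * L) ^ k) ^ i * (K ^ 2 * (T * L) ^ k) := fun i _ => by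
    refine le_mul_of_one_le_left (by positivity) (one_le_pow₀ ?_)
    have := Real.one_le_exp hTL
    have : 0 ≤ K * (T * L) ^ k := by positivity
    linarith
  simpa using Finset.card_nsmul_le_sum _ _ _ this

/-- Equality holds at `N = 2`. For `N ≥ 3`, `(2N-1)! ≥ N! (N+1)^(N-1) ≥ 2N · N^(N-1)`. -/
theorem three_mul_pow_le_two_mul_factorial (N : ℕ) (hN : 2 ≤ N) :
    3 * N ^ N ≤ 2 * (2 * N - 1).factorial := by
  obtain rfl | hN3 := hN.eq_or_lt
  · decide
  obtain ⟨M, rfl⟩ : ∃ M, N = M + 3 := ⟨N - 3, by omega⟩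
  have h1 : (M + 3).factorial * (M + 3 + 1) ^ (M + 2) ≤ (M + 3 + (M + 2)).factorial :=
    Nat.factorial_mul_pow_le_factorial
  have h2 : (M + 3) * 2 ≤ (M + 3).factorial := by
    rw [Nat.factorial_succ]
    exact Nat.mul_le_mul_left _ ((by omega : 2 ≤ M + 2).trans (Nat.self_le_factorial _))
  have h3 : (M + 3) ^ (M + 2) ≤ (M + 3 + 1) ^ (M + 2) := Nat.pow_le_pow_left (by omega) _
  have h4 : (M + 3) * 2 * (M + 3) ^ (M + 2) ≤ (M + 3).factorial * (M + 3 + 1) ^ (M + 2) :=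
    Nat.mul_le_mul h2 h3
  have e : 2 * (M + 3) - 1 = M + 3 + (M + 2) := by omega
  rw [e, pow_succ']
  nlinarith [Nat.zero_le ((M + 3) * (M + 3) ^ (M + 2))]

theorem three_mul_pow_mul_le_two_mul_factorial {N k : ℕ} (hN : 2 ≤ N) (hk : 2 ≤ k) :
    3 * N ^ (N * (k - 1)) ≤ 2 * (N * k - 1).factorial := by
  obtain ⟨l, rfl⟩ : ∃ l, k = l + 2 := ⟨k - 2, by omega⟩
  have h1 : (2 * N - 1).factorial * (2 * N - 1 + 1) ^ (N * l) ≤ (2 * N - 1 + N * l).factorial :=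
    Nat.factorial_mul_pow_le_factorial
  have h2 := three_mul_pow_le_two_mul_factorial N hN
  have h3 : N ^ (N * l) ≤ (2 * N - 1 + 1) ^ (N * l) := Nat.pow_le_pow_left (by omega) _
  have e : N * (l + 2) - 1 = 2 * N - 1 + N * l := by
    have : N * (l + 2) = 2 * N + N * l := by ring
    omega
  have e' : N * (l + 2 - 1) = N + N * l := by
    rw [show l + 2 - 1 = 1 + l by omega]; ring
  rw [e, e', pow_add]
  calc 3 * (N ^ N * N ^ (N * l)) = 3 * N ^ N * N ^ (N * l) := by ring
    _ ≤ 2 * (2 * N - 1).factorial * (2 * N - 1 + 1) ^ (N * l) := Nat.mul_le_mul h2 h3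
    _ = 2 * ((2 * N - 1).factorial * (2 * N - 1 + 1) ^ (N * l)) := by ring
    _ ≤ _ := Nat.mul_le_mul_left _ h1

theorem inv_sqrt_two_bounds : 0 < 1 / √(2 : ℝ) ∧ (1 / √(2 : ℝ)) ^ 2 = 1 / 2 ∧
    1 / √(2 : ℝ) < 0.7072 := by
  have h0 : 0 < 1 / √(2 : ℝ) := by positivity
  have h1 : (1 / √(2 : ℝ)) ^ 2 = 1 / 2 := by
    rw [div_pow, Real.sq_sqrt (by norm_num)]; norm_num
  exact ⟨h0, h1, by nlinarith⟩

/-- All error terms are controlled by `R = K² η m` with `m = N k`: taking the `N`-th power of `K²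
A^k ≤ N^(k-1) b` and comparing with `(m-1)!` gives `R ≤ (2/3) b²`. -/
theorem decrease_of_two_le {K A τ b : ℝ} {N k : ℕ} (hK : 1 ≤ K) (hA : 0 < A) (hN : 2 ≤ N)
    (hk : 2 ≤ k) (hAτ : A < N * τ) (hb : b = K ^ 2 * A * τ ^ (k - 1)) (hb1 : b < 0.3661) :
    2 * K * (1 + A ^ (N * k) / (N * k).factorial) *
      ((1 + (N * k - 1 : ℕ) * (2 * K)) * (A ^ (N * k) / (N * k).factorial)) +
      (1 / √2 + K * (A ^ (N * k) / (N * k).factorial)) ^ 2 < 1 := by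
  have hN0 : (0 : ℝ) < N := by positivity
  have hτ : 0 < τ := by
    by_contra! h
    nlinarith
  have hb0 : 0 < b := by rw [hb]; positivity
  set m := N * k with hm
  have hm4 : 4 ≤ m := Nat.mul_le_mul hN hk
  have h1 : K ^ 2 * A ^ k ≤ (N : ℝ) ^ (k - 1) * b := by
    obtain ⟨l, rfl⟩ : ∃ l, k = l + 1 := ⟨k - 1, by omega⟩
    have : A ^ l ≤ (N * τ) ^ l := by gcongr
    rw [hb, Nat.add_sub_cancel]
    calc K ^ 2 * A ^ (l + 1) = K ^ 2 * A * A ^ l := by ring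
      _ ≤ K ^ 2 * A * (N * τ) ^ l := by gcongr
      _ = _ := by rw [mul_pow]; ring
  have h2 : K ^ 2 * A ^ m ≤ (N : ℝ) ^ (N * (k - 1)) * b ^ 2 := by
    have hK2 : (1 : ℝ) ≤ K ^ 2 := one_le_pow₀ hK
    calc K ^ 2 * A ^ m ≤ (K ^ 2) ^ N * A ^ m := by
          gcongr
          exact le_self_pow₀ hK2 (by omega)
      _ = (K ^ 2 * A ^ k) ^ N := by rw [mul_pow, hm, mul_comm N k, pow_mul]
      _ ≤ ((N : ℝ) ^ (k - 1) * b) ^ N := by gcongr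
      _ = (N : ℝ) ^ (N * (k - 1)) * b ^ N := by rw [mul_pow, mul_comm N, pow_mul]
      _ ≤ _ := by
        gcongr ?_ * ?_
        exact pow_le_pow_of_le_one hb0.le (by linarith) hN
  have h3 : (3 : ℝ) * (N : ℝ) ^ (N * (k - 1)) ≤ 2 * (m - 1).factorial := by
    exact_mod_cast three_mul_pow_mul_le_two_mul_factorial hN hk
  set η := A ^ m / (m.factorial : ℝ) with hη
  have hη0 : 0 < η := by positivity
  set R := K ^ 2 * η * m with hR
  have hRe : R * (m - 1).factorial = K ^ 2 * A ^ m := by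
    have e : (m.factorial : ℝ) = m * (m - 1).factorial := by
      exact_mod_cast (Nat.mul_factorial_pred (by omega)).symm
    have hf : ((m - 1).factorial : ℝ) ≠ 0 := by positivity
    have hm0 : (m : ℝ) ≠ 0 := by positivity
    rw [hR, hη, e]
    field_simp
  have hf0 : (0 : ℝ) < (m - 1).factorial := by positivity
  have hR1 : R ≤ 2 / 3 * b ^ 2 := by
    have : R * (m - 1).factorial ≤ 2 / 3 * b ^ 2 * (m - 1).factorial := by
      rw [hRe]
      nlinarith [sq_nonneg b]
    exact le_of_mul_le_mul_right this hf0
  have hR2 : R ≤ 0.0894 := by nlinarith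
  have hm4' : (4 : ℝ) ≤ m := by exact_mod_cast hm4
  have hKη : K * η ≤ R / 4 := by
    have h4 : K * η * 4 ≤ K ^ 2 * η * m := by
      have : K ≤ K ^ 2 := by nlinarith
      gcongr
    linarith
  have hη1 : η ≤ R / 4 := by nlinarith
  have hcast : ((m - 1 : ℕ) : ℝ) = m - 1 := by
    rw [Nat.cast_sub (by omega)]; simp
  have ht : 2 * K * (1 + η) * ((1 + (m - 1 : ℕ) * (2 * K)) * η) ≤ 4 * (1 + R / 4) * R := by
    rw [hcast]
    have : 1 + ((m : ℝ) - 1) * (2 * K) ≤ 2 * K * m := by nlinarith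
    have hp : 0 ≤ (1 + ((m : ℝ) - 1) * (2 * K)) * η := by
      have : 0 ≤ (m : ℝ) - 1 := by linarith
      positivity
    calc _ ≤ 2 * K * (1 + R / 4) * ((2 * K * m) * η) := by gcongr
      _ = _ := by rw [hR]; ring
  obtain ⟨s0, s1, s2⟩ := inv_sqrt_two_bounds
  have hR0 : 0 ≤ R := by positivity
  have hsq : (1 / √2 + K * η) ^ 2 ≤ (0.7072 + 0.0894 / 4) ^ 2 := by
    gcongr
    linarith
  have : 4 * (1 + R / 4) * R ≤ 4 * (1 + 0.0894 / 4) * 0.0894 := by gcongr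
  norm_num at *
  linarith

theorem decrease_of_eq_one {K A τ b : ℝ} {k : ℕ} (hK : 1 ≤ K) (hA : 0 < A)
    (hk : 2 ≤ k) (hAτ : A < τ) (hτ : τ < 1 / 2) (hb : b = K ^ 2 * A * τ ^ (k - 1))
    (hb1 : b < 0.3661) (hb2 : b ^ 2 + b * (1 + b) * (1 + b / K) < 1 / 2) :
    2 * K * (1 + A ^ k / k.factorial) * (A ^ k / k.factorial) +
      (1 / √2 + K * (A ^ k / k.factorial)) ^ 2 < 1 := by
  set η := A ^ k / (k.factorial : ℝ) with hη
  have hη0 : 0 < η := by positivity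
  have hτ0 : 0 < τ := hA.trans hAτ
  have hb0 : 0 < b := by rw [hb]; positivity
  set y := K * η with hy
  have hy0 : 0 < y := by positivity
  have hηy : η ≤ y := by nlinarith
  have h1 : K ^ 2 * A ^ k ≤ b := by
    obtain ⟨l, rfl⟩ : ∃ l, k = l + 1 := ⟨k - 1, by omega⟩
    rw [hb, Nat.add_sub_cancel]
    calc K ^ 2 * A ^ (l + 1) = K ^ 2 * A * A ^ l := by ring
      _ ≤ K ^ 2 * A * τ ^ l := by gcongr
  have h2 : K * y * k.factorial ≤ b := by
    refine le_trans (le_of_eq ?_) h1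
    rw [hy, hη]
    have : (k.factorial : ℝ) ≠ 0 := by positivity
    field_simp
  have hyb : y < 0.13 := by
    obtain rfl | hk3 := hk.eq_or_lt
    · norm_num at h2 hη
      -- For `k = 2` the bound `2 K y ≤ b` alone is too weak. If `y ≥ 0.13`, then `A < 1/2` forces
      -- `K ≥ 8 y`, so both `b` and `b / K` are large enough to contradict `hb2`.
      by_contra! h
      have hyA : y = K * A ^ 2 / 2 := by rw [hy, hη]; ring
      have hK1 : 8 * y ≤ K := by
        have : A ^ 2 ≤ 1 / 4 := by nlinarith
        nlinarith
      have hv : 2 * y ≤ b / K := by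
        rw [le_div_iff₀ (by linarith)]; linarith
      have hbl : 0.2704 ≤ b := by nlinarith
      have h5 : 0.26 ≤ b / K := by linarith
      have : 0.2704 * (1 + 0.2704) * (1 + 0.26) ≤ b * (1 + b) * (1 + b / K) := by gcongr
      nlinarith
    · have : (6 : ℝ) ≤ k.factorial := by
        exact_mod_cast (Nat.factorial_le hk3 : (3).factorial ≤ _)
      have : K * y * 6 ≤ K * y * k.factorial := by gcongr
      nlinarith
  obtain ⟨s0, s1, s2⟩ := inv_sqrt_two_bounds
  have e : 2 * K * (1 + η) * η = 2 * y * (1 + η) := by rw [hy]; ring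
  rw [e]
  have t1 : 2 * y * (1 + η) ≤ 2 * 0.13 * (1 + 0.13) := by gcongr; linarith
  have t2 : (1 / √2 + y) ^ 2 ≤ (0.7072 + 0.13) ^ 2 := by gcongr
  norm_num at *
  linarith

theorem exists_weight {K A τ b : ℝ} {N k : ℕ} (hK : 1 ≤ K) (hA : 0 < A) (hN : 0 < N)
    (hk : 2 ≤ k) (hAτ : A < N * τ) (hτ : τ < 1 / 2) (hb : b = K ^ 2 * A * τ ^ (k - 1))
    (hb2 : b ^ 2 + b * (1 + b) * (1 + b / K) < 1 / 2) :
    ∃ w, 0 ≤ w ∧ (w = 2 * K ∨ A < 1 / 2) ∧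
      2 * K * (1 + A ^ (N * k) / (N * k).factorial) *
        ((1 + (N * k - 1 : ℕ) * w) * (A ^ (N * k) / (N * k).factorial)) +
        (1 / √2 + K * (A ^ (N * k) / (N * k).factorial)) ^ 2 < 1 := by
  have hN0 : (0 : ℝ) < N := by positivity
  have hτ0 : 0 < τ := by
    by_contra! h
    nlinarith
  have hb0 : 0 < b := by rw [hb]; positivity
  -- Already `b² + b (1 + b) < 1/2` forces `b < (√5 - 1) / 4 ≈ 0.309`, so there is slack.
  have hb1 : b < 0.3661 := by
    have h1 : 0 ≤ b / K := by positivity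
    have h2 : b * (1 + b) * 1 ≤ b * (1 + b) * (1 + b / K) := by gcongr; linarith
    nlinarith
  obtain rfl | hN2 := (Nat.succ_le_of_lt hN).eq_or_lt
  -- For `N = 1`, `A < τ < 1/2`: freezing occurs too late to matter, so it costs nothing.
  · refine ⟨0, le_rfl, Or.inr ?_, ?_⟩
    · norm_num at hAτ; linarith
    · norm_num at hAτ
      simpa using decrease_of_eq_one hK hA hk hAτ hτ hb hb1 hb2
  · exact ⟨2 * K, by linarith, Or.inl rfl, decrease_of_two_le hK hA hN2 hk hAτ hb hb1⟩

/-! ### Consequences of exponential decay and of the admissibility conditions. -/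

section

variable {n : ℕ} {F : EuclideanSpace ℝ (Fin n) → EuclideanSpace ℝ (Fin n)} {L ρ B : ℝ}
  {x : EuclideanSpace ℝ (Fin n)} {φ : ℝ → EuclideanSpace ℝ (Fin n)}

/-- Composing with `max t 0` makes `φ`, controlled only on `[0, ∞)`, continuous on all of `ℝ`. -/
theorem IsSolution.isTrajectory (hF : Continuous F) (hφ : IsSolution F x φ)
    (hB : ∀ t, 0 ≤ t → ‖φ t‖ ≤ B) : IsTrajectory F x (fun t => φ (max t 0)) B := by
  have hcont : ContinuousOn φ (Set.Ici 0) := fun t ht => (hφ.2 t ht).continuousWithinAt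
  have hc : Continuous fun t => φ (max t 0) :=
    hcont.comp_continuous (continuous_id.max continuous_const) fun t => Set.mem_Ici.2 (le_max_right _ _)
  refine ⟨hc, fun t ht => ?_, fun t _ => hB _ (le_max_right _ _)⟩
  have hcF : ContinuousOn (fun s => F (φ s)) (Set.uIcc 0 t) := by
    rw [Set.uIcc_of_le ht]
    exact hF.comp_continuousOn (hcont.mono Set.Icc_subset_Ici_self)
  have h := intervalIntegral.integral_eq_sub_of_hasDeriv_right_of_le ht
    (hcont.mono Set.Icc_subset_Ici_self)
    (fun s hs => (hφ.2 s hs.1.le).mono fun u hu => (hs.1.trans hu).le) hcF.intervalIntegrable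
  have e : ∫ s in (0 : ℝ)..t, F (φ (max s 0)) = ∫ s in (0 : ℝ)..t, F (φ s) := by
    refine intervalIntegral.integral_congr fun s hs => ?_
    rw [Set.uIcc_of_le ht] at hs
    simp only [max_eq_left hs.1]
  rw [e, h, max_eq_left ht, hφ.1]
  abel

theorem tendsto_const_mul_exp_neg (C : ℝ) {μ : ℝ} (hμ : 0 < μ) :
    Tendsto (fun t : ℝ => C * Real.exp (-μ * t)) atTop (𝓝 0) := by
  have h : Tendsto (fun t : ℝ => -μ * t) atTop atBot :=
    tendsto_id.const_mul_atTop_of_neg (by linarith)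
  simpa using (Real.tendsto_exp_atBot.comp h).const_mul C

theorem IsTrajectory.field_zero_eq_zero {C μ : ℝ} (hF : Continuous F) (hL : 0 ≤ L) (hμ : 0 < μ)
    (hlip : ∀ x y, ‖x‖ ≤ ρ → ‖y‖ ≤ ρ → ‖F x - F y‖ ≤ L * ‖x - y‖)
    (hφ : IsTrajectory F x φ B) (hB : B ≤ ρ)
    (hdec : ∀ t, 0 ≤ t → ‖φ t‖ ≤ C * Real.exp (-μ * t)) : F 0 = 0 := by
  have hC : 0 ≤ C := by simpa using (norm_nonneg _).trans (hdec 0 le_rfl)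
  have key : ∀ t, 0 ≤ t → ‖F 0‖ ≤ (L + 2) * C * Real.exp (-μ * t) := by
    intro t ht
    have hmono : ∀ s, 0 ≤ s → ‖φ (s + t)‖ ≤ C * Real.exp (-μ * t) := fun s hs =>
      (hdec _ (by linarith)).trans
        (mul_le_mul_of_nonneg_left (Real.exp_le_exp.2 (by nlinarith)) hC)
    have hs := (hφ.shift hF ht).eq_integral 1 zero_le_one
    have hc : Continuous fun s => F (φ (s + t)) := hF.comp (hφ.shift hF ht).continuous
    -- Every term on the right decays as `t → ∞`.
    have e : F 0 = (φ (1 + t) - φ t) - ∫ s in (0 : ℝ)..1, (F (φ (s + t)) - F 0) := by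
      rw [intervalIntegral.integral_sub (hc.intervalIntegrable _ _) intervalIntegrable_const, hs]
      simp
    have b : ‖∫ s in (0 : ℝ)..1, (F (φ (s + t)) - F 0)‖ ≤ L * (C * Real.exp (-μ * t)) := by
      have := intervalIntegral.norm_integral_le_of_norm_le_const (a := 0) (b := 1)
        (C := L * (C * Real.exp (-μ * t))) (f := fun s => F (φ (s + t)) - F 0) fun s hs => ?_
      · simpa using this
      · rw [Set.uIoc_of_le zero_le_one] at hs
        have h1 : ‖φ (s + t)‖ ≤ ρ := (hφ.norm_le _ (by linarith [hs.1])).trans hB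
        refine (hlip _ 0 h1 (by simpa using (norm_nonneg _).trans h1)).trans ?_
        rw [sub_zero]
        have := hmono s hs.1.le
        gcongr
    have h0 := hmono 0 le_rfl
    rw [zero_add] at h0
    have h1 := hmono 1 zero_le_one
    rw [e]
    refine (_root_.norm_sub_le _ _).trans ?_
    have := _root_.norm_sub_le (φ (1 + t)) (φ t)
    linarith
  have : ‖F 0‖ ≤ 0 := ge_of_tendsto (tendsto_const_mul_exp_neg _ hμ)
    ((eventually_ge_atTop 0).mono key)
  simpa using this

/-- Grönwall's inequality for the time-reversed solution: the norm cannot shrink faster than `e^(-L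
t)`. -/
theorem IsSolution.norm_le_mul_exp (hF : IsLipschitzField F L ρ) (hφ : IsSolution F x φ)
    (hρ : ∀ t, 0 ≤ t → ‖φ t‖ ≤ ρ) {t : ℝ} (ht : 0 ≤ t) : ‖x‖ ≤ ‖φ t‖ * Real.exp (L * t) := by
  have hcont : ContinuousOn φ (Set.Ici 0) := fun t ht => (hφ.2 t ht).continuousWithinAt
  have h := norm_le_gronwallBound_of_norm_deriv_right_le (f := fun s => φ (t - s))
    (f' := fun s => -F (φ (t - s))) (δ := ‖φ t‖) (K := L) (ε := 0) (a := 0) (b := t)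
    (hcont.comp (by fun_prop) fun s hs => sub_nonneg.2 hs.2)
    (fun s hs => ?_) (by simp) (fun s hs => ?_) t ⟨ht, le_rfl⟩
  · simpa [gronwallBound_ε0, hφ.1] using h
  · have h1 : 0 < t - s := sub_pos.2 hs.2
    have h2 := (hφ.2 (t - s) h1.le).hasDerivAt (Ici_mem_nhds h1)
    exact (h2.comp_const_sub t s).hasDerivWithinAt
  · rw [norm_neg, add_zero]
    exact hF.norm_le (hρ _ (sub_nonneg.2 hs.2.le))

theorem IsSolution.rate_le {C μ : ℝ} (hF : IsLipschitzField F L ρ) (hφ : IsSolution F x φ)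
    (hx : x ≠ 0) (hρ : ∀ t, 0 ≤ t → ‖φ t‖ ≤ ρ)
    (hdec : ∀ t, 0 ≤ t → ‖φ t‖ ≤ C * Real.exp (-μ * t)) : μ ≤ L := by
  by_contra! hlt
  have key : ∀ t, 0 ≤ t → ‖x‖ ≤ C * Real.exp (-(μ - L) * t) := fun t ht => by
    refine (hφ.norm_le_mul_exp hF hρ ht).trans ?_
    calc _ ≤ C * Real.exp (-μ * t) * Real.exp (L * t) := by gcongr; exact hdec t ht
      _ = _ := by rw [mul_assoc, ← Real.exp_add]; congr 2; ring
  have : ‖x‖ ≤ 0 := ge_of_tendsto (tendsto_const_mul_exp_neg _ (sub_pos.2 hlt))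
    ((eventually_ge_atTop 0).mono key)
  exact hx (by simpa using this)

theorem vectorField_eq_of_totalDegree_eq_zero {f : Fin n → MvPolynomial (Fin n) ℝ}
    (hf : ∀ i, (f i).totalDegree ≤ 0) (x y : EuclideanSpace ℝ (Fin n)) :
    vectorField f x = vectorField f y := by
  have : ∀ i, f i = MvPolynomial.C ((f i).coeff 0) := fun i =>
    MvPolynomial.totalDegree_eq_zero_iff_eq_C.1 (Nat.le_zero.1 (hf i))
  unfold vectorField
  congr 1
  funext i
  rw [this i, MvPolynomial.eval_C, MvPolynomial.eval_C]

/-- The part of the degree bound inequalities that the construction uses. -/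
theorem Admissible.exists_error {K rate L T : ℝ} {N k : ℕ} (h : Admissible K rate L T N k)
    (hK : 1 ≤ K) (hrate : 0 < rate) (hL : 0 < L) (hrL : rate ≤ L) :
    2 ≤ k ∧ ∃ b, b = K ^ 2 * (L * (Real.log (2 * K ^ 2) / (2 * rate))) * (T * L) ^ (k - 1) ∧
      b ^ 2 + b * (1 + b) * (1 + b / K) < 1 / 2 := by
  have hT := h.T_pos
  have hK0 : 0 < K := by linarith
  have hlog : Real.log 2 ≤ Real.log (2 * K ^ 2) := Real.log_le_log (by norm_num) (by nlinarith)
  have hlog2 := Real.log_two_gt_d9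
  set δ := Real.log (2 * K ^ 2) / (2 * rate) with hδ
  have hδ0 : 0 < δ := div_pos (by linarith) (by linarith)
  set b := K ^ 2 * (L * δ) * (T * L) ^ (k - 1) with hb
  have hb0 : 0 < b := by positivity
  obtain ⟨l, rfl⟩ : ∃ l, k = l + 1 := ⟨k - 1, by have := h.k_pos; omega⟩
  rw [Nat.add_sub_cancel] at hb
  set c := picardError K L T N (l + 1) with hc
  -- `b` is `N K² (T L)^k` with `N T` replaced by the smaller horizon `δ`.
  have hbc : b ≤ c := by
    refine le_trans ?_ (mul_le_picardError hK (by positivity) N (l + 1))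
    have := h.horizon.le
    calc b = K ^ 2 * (L * (T * L) ^ l) * δ := by rw [hb]; ring
      _ ≤ K ^ 2 * (L * (T * L) ^ l) * (N * T) := by gcongr
      _ = _ := by ring
  have hb2 : b ^ 2 + b * (1 + b) * (1 + b / K) < 1 / 2 := by
    refine lt_of_le_of_lt ?_ h.decrease
    have e : b * (1 + b) * (1 + b / K) =
        δ * K * ((T * L) ^ (l + 1) / T) * (1 + b) * (K + b) := by
      have : K * (1 + b / K) = K + b := by field_simp
      rw [← this]
      nth_rewrite 1 [hb]
      rw [pow_succ]
      field_simp
      ring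
    rw [e, ← hδ, ← hc]
    have : 0 ≤ c := hb0.le.trans hbc
    gcongr
  refine ⟨?_, b, rfl, hb2⟩
  -- For `k = 1`, `b = K² L δ ≥ (log 2) / 2` because `rate ≤ L`, which contradicts `hb2`.
  by_contra! hk
  obtain rfl : l = 0 := by omega
  have hA : 0.3465 ≤ L * δ := by
    rw [hδ, ← mul_div_assoc, le_div_iff₀ (by linarith)]
    nlinarith
  have hb3 : 0.3465 ≤ b := by
    rw [hb, pow_zero, mul_one]
    have : (1 : ℝ) ≤ K ^ 2 := one_le_pow₀ hK
    nlinarith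
  have h1 : 0 ≤ b / K := by positivity
  have h2 : b * (1 + b) * 1 ≤ b * (1 + b) * (1 + b / K) := by gcongr; linarith
  nlinarith

theorem mul_exp_neg_horizon {K rate : ℝ} (hK : 0 < K) (hrate : 0 < rate) :
    K * Real.exp (-rate * (Real.log (2 * K ^ 2) / (2 * rate))) = 1 / √2 := by
  have e : -rate * (Real.log (2 * K ^ 2) / (2 * rate)) = -Real.log (√2 * K) := by
    rw [← Real.sqrt_sq hK.le, ← Real.sqrt_mul (by norm_num), Real.log_sqrt (by positivity),
      Real.sqrt_sq hK.le]
    field_simp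
  rw [e, Real.exp_neg, Real.exp_log (by positivity)]
  field_simp

end

end ConverseSOS

end

/-! ### Assembly of the converse theorem. -/

open ConverseSOS in
theorem mainTheorem3 (n q : ℕ) (f : Fin n → MvPolynomial (Fin n) ℝ)
    (hq : ∀ i, (f i).totalDegree ≤ q)
    (M : Set (EuclideanSpace ℝ (Fin n))) (hM : M.Nonempty)
    (r : ℝ) (hMr : M ⊆ Metric.closedBall 0 r)
    (K rate L T : ℝ) (hK : 1 ≤ K) (hrate : 0 < rate) (hL : 0 < L)
    (hLip : ∀ x ∈ Metric.closedBall (0 : EuclideanSpace ℝ (Fin n)) (4 * K * r),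
      ∀ y ∈ Metric.closedBall (0 : EuclideanSpace ℝ (Fin n)) (4 * K * r),
        ‖ConverseSOS.vectorField f x - ConverseSOS.vectorField f y‖ ≤ L * ‖x - y‖)
    (N k : ℕ) (hadm : ConverseSOS.Admissible K rate L T N k)
    (d : ℕ) (hd : d = q ^ (N * k - 1))
    (hstable : ∃ μ : ℝ, rate ≤ μ ∧ ConverseSOS.ExpStableOn (ConverseSOS.vectorField f) M K μ) :
    ∃ α β γ : ℝ, 0 < α ∧ 0 < β ∧ 0 < γ ∧
      ∃ P : Matrix (Fin (ConverseSOS.numMonomials n d)) (Fin (ConverseSOS.numMonomials n d)) ℝ,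
        P.PosSemidef ∧
        (∀ x ∈ M, α * ‖x‖ ^ 2 ≤ ConverseSOS.gramForm P x ∧
          ConverseSOS.gramForm P x ≤ β * ‖x‖ ^ 2) ∧
        (∀ x ∈ M, inner ℝ (gradient (ConverseSOS.gramForm P) x) (ConverseSOS.vectorField f x) ≤
          -γ * ‖x‖ ^ 2) := by
  obtain ⟨μ, hμ, hstab⟩ := hstable
  have hμ0 : 0 < μ := hrate.trans_le hμ
  have hK0 : 0 < K := by linarith
  set F := vectorField f with hFdef
  have hcF : Continuous F := continuous_vectorField f
  have hr : ∀ x ∈ M, ‖x‖ ≤ r := fun x hx => by simpa using hMr hx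
  -- The facts `rate ≤ L` and `1 ≤ q` come from a nonzero trajectory, so `M = {0}` is treated apart.
  by_cases hM0 : ∀ x ∈ M, x = 0
  · refine ⟨1, 1, 1, one_pos, one_pos, one_pos, 0, Matrix.PosSemidef.zero, fun x hx => ?_,
      fun x hx => ?_⟩
    · simp [hM0 x hx, gramForm]
    · have : gramForm (0 : Matrix (Fin (numMonomials n d)) (Fin (numMonomials n d)) ℝ) =
          fun _ => 0 := by
        funext x; simp [gramForm]
      simp [this, hM0 x hx]
  push Not at hM0
  obtain ⟨x₀, hx₀M, hx₀⟩ := hM0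
  have hlip : ∀ x y, ‖x‖ ≤ 4 * K * r → ‖y‖ ≤ 4 * K * r → ‖F x - F y‖ ≤ L * ‖x - y‖ :=
    fun x y hx hy => hLip x (by simpa using hx) y (by simpa using hy)
  have hball : ∀ x ∈ M, 2 * (K * ‖x‖) ≤ 4 * K * r := fun x hx => by
    have := hr x hx
    nlinarith [norm_nonneg x]
  have hbdd : ∀ x ∈ M, ∀ φ : ℝ → EuclideanSpace ℝ (Fin n),
      (∀ t : ℝ, 0 ≤ t → ‖φ t‖ ≤ K * ‖x‖ * Real.exp (-μ * t)) → ∀ t, 0 ≤ t → ‖φ t‖ ≤ K * ‖x‖ :=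
    fun x hx φ h t ht => (h t ht).trans (mul_le_of_le_one_right (by positivity)
      (Real.exp_le_one_iff.2 (by nlinarith)))
  have hdec' : ∀ (x : EuclideanSpace ℝ (Fin n)) (φ : ℝ → EuclideanSpace ℝ (Fin n)),
      (∀ t : ℝ, 0 ≤ t → ‖φ t‖ ≤ K * ‖x‖ * Real.exp (-μ * t)) →
        ∀ t, 0 ≤ t → ‖φ (max t 0)‖ ≤ K * ‖x‖ * Real.exp (-μ * t) :=
    fun x φ h t ht => by simpa only [max_eq_left ht] using h t ht
  obtain ⟨φ₀, hφ₀, hdec₀⟩ := hstab x₀ hx₀M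
  have hb₀ := hbdd x₀ hx₀M φ₀ hdec₀
  have hρ₀ : K * ‖x₀‖ ≤ 4 * K * r := by
    have := hball x₀ hx₀M
    have : 0 ≤ K * ‖x₀‖ := by positivity
    linarith
  have hF0 : F 0 = 0 := (hφ₀.isTrajectory hcF hb₀).field_zero_eq_zero hcF hL.le hμ0 hlip hρ₀
    (hdec' x₀ φ₀ hdec₀)
  have hF : IsLipschitzField F L (4 * K * r) := ⟨hcF, hF0, hlip⟩
  have hrL : rate ≤ L := hμ.trans
    (hφ₀.rate_le hF hx₀ (fun t ht => (hb₀ t ht).trans hρ₀) hdec₀)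
  -- A field of degree zero is constant, hence Lipschitz with any constant; the constant `μ / 2`
  -- contradicts decay at rate `μ`.
  have hq1 : 1 ≤ q := by
    by_contra! h
    obtain rfl : q = 0 := by omega
    have hF' : IsLipschitzField F (μ / 2) (4 * K * r) := ⟨hcF, hF0, fun x y _ _ => by
      rw [hFdef, vectorField_eq_of_totalDegree_eq_zero hq x y, sub_self, norm_zero]
      positivity⟩
    have := hφ₀.rate_le hF' hx₀ (fun t ht => (hb₀ t ht).trans hρ₀) hdec₀
    linarith
  obtain ⟨hk, b, hb, hb2⟩ := hadm.exists_error hK hrate hL hrL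
  set δ := Real.log (2 * K ^ 2) / (2 * rate) with hδdef
  have hδ : 0 < δ := div_pos (Real.log_pos (by nlinarith)) (by linarith)
  have hAτ : L * δ < N * (T * L) := by nlinarith [hadm.horizon]
  have hτ : T * L < 1 / 2 := by
    have := hadm.T_lt
    rw [lt_div_iff₀ (by linarith)] at this
    linarith
  obtain ⟨w, hw0, hw, hη⟩ := exists_weight hK (mul_pos hL hδ) hadm.N_pos hk hAτ hτ hb hb2
  obtain ⟨a, ha⟩ := exists_isCutoff hL
  obtain ⟨j, hj⟩ : ∃ j, N * k = j + 1 :=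
    ⟨N * k - 1, by have := Nat.mul_pos hadm.N_pos hadm.k_pos; omega⟩
  rw [hj, Nat.add_sub_cancel] at hη hd
  subst hd
  set η := expTerm L (j + 1) δ with hηdef
  change 2 * K * (1 + η) * ((1 + j * w) * η) + (1 / √2 + K * η) ^ 2 < 1 at hη
  have hη0 : 0 ≤ η := expTerm_nonneg hL.le hδ.le _
  obtain ⟨P, hP, hV⟩ := exists_posSemidef_gramForm
    (picard_mem_polySpan hq1 f hq a j) (continuous_picard hcF j) hδ.le
  change ∀ x, gramForm P x = lyapunov F a j δ x at hV
  -- Up to `t₀` the iterate has norm at least `‖x‖ / 2`, whence `α = t₀ / 4`.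
  set t₀ := min δ (1 / (4 * (K * L))) with ht₀def
  have hKL : 0 < 4 * (K * L) := by positivity
  have ht₀ : 0 < t₀ := lt_min hδ (by positivity)
  have ht₀' : t₀ * (4 * (K * L)) ≤ 1 := by
    rw [← le_div_iff₀ hKL]; exact min_le_right _ _
  refine ⟨t₀ / 4, δ * (K * (1 + η)) ^ 2,
    1 - (2 * K * (1 + η) * ((1 + j * w) * η) + (1 / √2 + K * η) ^ 2), by positivity,
    by positivity, by linarith, P, hP, fun x hx => ?_, fun x hx => ?_⟩
  · obtain ⟨φ, hφ, hdec⟩ := hstab x hx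
    have htr := hφ.isTrajectory hcF (hbdd x hx φ hdec)
    rw [hV]
    constructor
    · refine le_trans (le_of_eq (by ring)) (le_lyapunov hF hL.le ha htr (hball x hx) j ht₀.le
        (min_le_left _ _) ?_ ?_)
      · have : 0 < L * t₀ := by positivity
        nlinarith
      · calc _ = t₀ * (4 * (K * L)) * ‖x‖ := by ring
          _ ≤ 1 * ‖x‖ := by gcongr
          _ = _ := one_mul _
    · exact (lyapunov_le hF hL.le ha htr (hball x hx) j hδ.le).trans (le_of_eq (by ring))
  · obtain ⟨φ, hφ, hdec⟩ := hstab x hx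
    have htr := hφ.isTrajectory hcF (hbdd x hx φ hdec)
    have hS : ∀ t, δ ≤ t → ‖φ (max t 0)‖ ≤ 1 / √2 * ‖x‖ := fun t ht => by
      refine (hdec' x φ hdec t (hδ.le.trans ht)).trans ?_
      rw [← mul_exp_neg_horizon hK0 hrate, ← hδdef]
      have : -μ * t ≤ -rate * δ := by nlinarith
      calc _ ≤ K * ‖x‖ * Real.exp (-rate * δ) := by gcongr
        _ = _ := by ring
    -- If `L δ < 1/2`, the premise fails, since `a i ≥ 1 / L`.
    have hcut : ∀ i, a i < δ + 1 / (2 * L) → 2 * (K * ‖x‖) ≤ w * ‖x‖ := fun i hi => by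
      rcases hw with rfl | hA
      · exact le_of_eq (by ring)
      · have h1 := ha.inv_le hL i
        have h2 : δ < 1 / (2 * L) := by
          rw [lt_div_iff₀ (by positivity)]; linarith
        have h3 : 1 / (2 * L) + 1 / (2 * L) = 1 / L := by field_simp; norm_num
        linarith
    have hφ0 : HasDerivWithinAt (fun t => φ (max t 0)) (F x) (Set.Ici 0) 0 := by
      have := hφ.2 0 Set.self_mem_Ici
      rw [hφ.1] at this
      exact this.congr (fun t ht => by rw [max_eq_left ht]) (by simp)
    -- The identity `hV` holds on the whole space, so the chain rule applies even if the trajectory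
    -- leaves `M`.
    have hv : HasDerivWithinAt (fun h => lyapunov F a j δ (φ (max h 0)))
        (inner ℝ (gradient (gramForm P) x) (F x)) (Set.Ici 0) 0 := by
      have hg := (differentiable_gramForm P x).hasGradientAt.hasFDerivAt
      have hx0 : φ (max 0 0) = x := by simpa using hφ.1
      have := HasFDerivAt.comp_hasDerivWithinAt_of_eq (0 : ℝ) hg hφ0 hx0.symm
      simpa [Function.comp_def, hV] using this
    refine (lyapunov_deriv_le hF hL ha htr (hball x hx) hδ.le hw0 (by positivity)
      (by field_simp; norm_num) hcut hS j hv).trans (le_of_eq ?_)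
    ring
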